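/- Let $d\ge 2$ and let $\Gamma^d=(V,L)$ be the infinite tree in which every vertex has exactly $d+1$ neighbours; $\vec L$ denotes its set of oriented edges. Let $Q:\mathbb Z\to(0,\infty)$ be even with $Q(0)=1$ and $Q\in\ell_1(\mathbb Z)$. For $S\subset\mathbb Z$ and $1\le p<\infty$ put $\|Q\|_{p,S}=\big(\sum_{j\in S}Q(j)^p\big)^{1/p}$, and let $$G_d=\Big\{(\gamma,\delta)\in(1,\infty)\times(0,\infty)\ :\ \exists\,\varepsilon>0,\ \ \delta+\gamma\varepsilon^d\le\varepsilon\ \text{ and }\ 2d\gamma\varepsilon^{d-1}+2d\delta\varepsilon^d<1\Big\}.$$ *Gradient Gibbs measures.* For a height configuration $\omega\in\mathbb Z^V$ let $\nabla\omega\in\mathbb Z^{\vec L}$, $(\nabla\omega)_{(x,y)}=\omega_y-\omega_x$. For finite $\Lambda\subset V$ let $\gamma_\Lambda(\cdot\mid\omega)$ be the probability kernel that fixes the configuration $\omega$ off $\Lambda$ and gives $\sigma$ with $\sigma=\omega$ off $\Lambda$ the weight $Z_\Lambda(\omega)^{-1}\prod_{\{x,y\}\in L,\ \{x,y\}\cap\Lambda\ne\emptyset}Q(\sigma_x-\sigma_y)$.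 For $\zeta=\nabla\omega$ let $\gamma'_\Lambda(\cdot\mid\zeta)$ be the image of $\gamma_\Lambda(\cdot\mid\omega)$ under $\nabla$ (this does not depend on the choice of $\omega$). A gradient Gibbs measure (GGM) for $Q$ is a probability measure $\nu$ on $\mathbb Z^{\vec L}$ that is carried by the gradient configurations $\nabla\omega$ and satisfies $\int\gamma'_\Lambda(A\mid\zeta)\,\nu(d\zeta)=\nu(A)$ for all finite $\Lambda\subset V$ and all measurable $A$. The free state is the law under which the increments along the edges of the tree are i.i.d. with distribution $Q/\|Q\|_{1,\mathbb Z}$ (the increment changes sign with the orientation of the edge). *GGMs from periodic boundary laws.* Let $q\ge1$. A $q$-periodic boundary law for $Q$ is a $q$-periodic function $\lambda:\mathbb Z\to(0,\infty)$ such that, for some constant $c>0$, $$\lambda(i)=c\Big(\sum_{j\in\mathbb Z}Q(i-j)\lambda(j)\Big)^d\qquad(i\in\mathbb Z);$$ it is regarded as a function on $\mathbb Z_q=\mathbb Z/q\mathbb Z$ (its minimal period may be a proper divisor of $q$). With $Q_q(\bar s)=\sum_{l\in\bar s}Q(l)$, put $$P'(\bar s,\bar t)=\frac{Q_q(\bar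 s-\bar t)\lambda(\bar t)}{\sum_{\bar u\in\mathbb Z_q}Q_q(\bar s-\bar u)\lambda(\bar u)},\qquad \alpha(\bar s)=\frac{\lambda(\bar s)^{(d+1)/d}}{\sum_{\bar t\in\mathbb Z_q}\lambda(\bar t)^{(d+1)/d}},\qquad \rho(j\mid\bar s)=1_{\{j\in\bar s\}}\frac{Q(j)}{Q_q(\bar s)} .$$ The gradient measure $\nu^\lambda$ on $\mathbb Z^{\vec L}$ associated with $\lambda$ is obtained by sampling first the tree-indexed Markov chain $(\sigma'_x)_{x\in V}$ on $\mathbb Z_q$ with single-site marginal $\alpha$ and transition matrix $P'$, and then, given $\sigma'$, the increments $\eta_{(x,y)}=-\eta_{(y,x)}$ independently over the edges, with law $\rho(\cdot\mid\sigma'_y-\sigma'_x)$. Then the following holds. 1. If $(\|Q\|_{1,\mathbb Z},\|Q\|_{1,\mathbb Z\setminus\{0\}})\in G_d$, then for every $q\ge2$ there is a $q$-periodic boundary law $\lambda$ for $Q$ such that the associated measure $\nu^\lambda$ is a GGM for $Q$, is invariant under all automorphisms of the tree, and is not equal to the free state. 2. Let $\tilde Q(i)=\sup_{|j|\ge|i|}Q(j)$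 and assume $$\sum_{i=1}^\infty\Big(\sum_{j=1}^\infty\tilde Q(ij)\Big)^{\frac{d+1}2}<\infty .$$ If $(\|Q\|_{\frac{d+1}2,\mathbb Z},\|Q\|_{d+1,\mathbb Z\setminus\{0\}})$ lies in the interior of $G_d$, then there is $q_0=q_0(Q,d)$ such that for every $q\ge q_0$ there is a $q$-periodic boundary law $\lambda$ for $Q$ such that the associated measure $\nu^\lambda$ is a GGM for $Q$, is invariant under all automorphisms of the tree, and is not equal to the free state. -/

import Mathlib

open MeasureTheory
open scoped ENNReal

noncomputable section

namespace TreeGradient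

/-! ### Norms, the good set and the monotone envelope -/

/-- The norm `‖x‖_{p,S} = (∑_{j ∈ S} |x j|^p)^{1/p}` for a real exponent `p`. -/
def pNorm (p : ℝ) {S : Type*} (x : S → ℝ) : ℝ :=
  (∑' j : S, |x j| ^ p) ^ (1 / p)

/-- `‖Q‖_{p,ℤ∖{0}}`. -/
def pNormOffZero (p : ℝ) (Q : ℤ → ℝ) : ℝ :=
  pNorm p (fun j : {j : ℤ // j ≠ 0} => Q j)

/-- The good set `G_d`. -/
def goodSet (d : ℕ) : Set (ℝ × ℝ) :=
  {p | 1 < p.1 ∧ 0 < p.2 ∧ ∃ ε : ℝ, 0 < ε ∧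
    p.2 + p.1 * ε ^ d ≤ ε ∧
    2 * d * p.1 * ε ^ (d - 1) + 2 * d * p.2 * ε ^ d < 1}

/-- The envelope `Q̃(i) = sup_{|j| ≥ |i|} Q(j)`. -/
def envelope (Q : ℤ → ℝ) (i : ℤ) : ℝ :=
  ⨆ j : {j : ℤ // |i| ≤ |j|}, Q j

/-- `∑_{i ≥ 1} (∑_{j ≥ 1} Q̃(i j))^{(d+1)/2} < ∞`; the sums are taken in `[0,∞]`, so that the
inner sums are required to be finite as well. -/
def DoubleSumCondition (Q : ℤ → ℝ) (d : ℕ) : Prop :=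
  ∑' i : ℕ, (∑' j : ℕ, ENNReal.ofReal (envelope Q (((i : ℤ) + 1) * ((j : ℤ) + 1))))
    ^ (((d : ℝ) + 1) / 2) < ∞

/-! ### Height-periodic boundary laws and the fuzzy chain -/

section Periodic

variable {q : ℕ}

/-- A spatially homogeneous `q`-height-periodic boundary law for `Q` on the tree in which every
vertex has `d + 1` neighbours. A `q`-periodic function on `ℤ` is written as
`i ↦ lam (i mod q)` with `lam : ZMod q → ℝ`. -/
structure IsPeriodicBoundaryLaw (Q : ℤ → ℝ) (d : ℕ) (lam : ZMod q → ℝ) : Prop where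
  pos : ∀ s, 0 < lam s
  eqn : ∃ c : ℝ, 0 < c ∧
    ∀ i : ℤ, lam (i : ZMod q) = c * (∑' j : ℤ, Q (i - j) * lam (j : ZMod q)) ^ d

/-- The fuzzy transfer operator `Q_q(s) = ∑_{l ∈ s} Q(l)` on residue classes mod `q`. -/
def fuzzyQ (Q : ℤ → ℝ) (s : ZMod q) : ℝ :=
  ∑' l : {l : ℤ // (l : ZMod q) = s}, Q l

/-- The conditional law `ρ(j | s) = 1_{j ∈ s} Q(j) / Q_q(s)` of an integer increment `j` given its
residue class `s`. -/
def rho (Q : ℤ → ℝ) (j : ℤ) (s : ZMod q) : ℝ :=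
  if (j : ZMod q) = s then Q j / fuzzyQ Q s else 0

variable [NeZero q]

/-- The transition matrix `P'(s,t) = Q_q(s-t) lam(t) / ∑_u Q_q(s-u) lam(u)` of the fuzzy chain. -/
def fuzzyTransition (Q : ℤ → ℝ) (lam : ZMod q → ℝ) (s t : ZMod q) : ℝ :=
  fuzzyQ Q (s - t) * lam t / ∑ u : ZMod q, fuzzyQ Q (s - u) * lam u

/-- The stationary distribution `α(s) = lam(s)^{(d+1)/d} / ∑_t lam(t)^{(d+1)/d}`. -/
def fuzzyStationary (d : ℕ) (lam : ZMod q → ℝ) (s : ZMod q) : ℝ :=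
  lam s ^ (((d : ℝ) + 1) / d) / ∑ t : ZMod q, lam t ^ (((d : ℝ) + 1) / d)

end Periodic

section Tree

variable {V : Type*} (G : SimpleGraph V)

/-- The product over all edges `{x,y}` of a tree `G` with both endpoints in `Λ`. Each edge occurs
once, as the pair `(x,y)` that points away from the vertex `w`. -/
def treeProd (Λ : Finset V) (w : V) (f : Λ → Λ → ℝ) : ℝ :=
  open Classical in
  ∏ x : Λ, ∏ y : Λ,
    if G.Adj x y ∧ G.dist w y = G.dist w x + 1 then f x y else 1

/-- `P` is the law on `(ZMod q)^V` of the tree-indexed fuzzy chain: the tree-indexed Markov chain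
with transition matrix `P'` and single-site marginal `α`, given by its marginals on finite
connected sets. -/
structure IsFuzzyChain {q : ℕ} [NeZero q] (Q : ℤ → ℝ) (d : ℕ) (lam : ZMod q → ℝ)
    (P : Measure (V → ZMod q)) : Prop where
  prob : IsProbabilityMeasure P
  marginal : ∀ Λ : Finset V, (G.induce (Λ : Set V)).Connected → ∀ (w : Λ) (s : Λ → ZMod q),
    P {σ | ∀ x : Λ, σ x = s x} =
      ENNReal.ofReal (fuzzyStationary d lam (s w) *
        treeProd G Λ w (fun x y => fuzzyTransition Q lam (s x) (s y)))

/-- The gradient `(∇ω)_{(x,y)} = ω_y - ω_x` of a height configuration, a function on oriented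
edges. -/
def grad (ω : V → ℤ) : G.Dart → ℤ :=
  fun e => ω e.snd - ω e.fst

/-- `ν` is the gradient measure `ν^lam` of the two-layer construction: sample the fuzzy chain `σ'`,
then, given `σ'`, sample the integer increments independently over the edges, with law
`ρ(· | σ'_y - σ'_x)` on the oriented edge `(x,y)`. The measure is given by the probabilities of
the events `η_Λ = ζ_Λ`, where `Λ` is a finite set of vertices and `ζ = ∇ω` is a gradient
configuration. -/
def IsTwoLayerMeasure {q : ℕ} [NeZero q] (Q : ℤ → ℝ) (d : ℕ) (lam : ZMod q → ℝ)
    (ν : Measure (G.Dart → ℤ)) : Prop :=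
  open Classical in
  IsProbabilityMeasure ν ∧
  ∃ P : Measure (V → ZMod q), IsFuzzyChain G Q d lam P ∧
    ∀ (Λ : Finset V) (w : V) (ω : V → ℤ),
      ν {η | ∀ e : G.Dart, e.fst ∈ Λ → e.snd ∈ Λ → η e = grad G ω e} =
        ∑ s : Λ → ZMod q, P {σ | ∀ x : Λ, σ x = s x} *
          ENNReal.ofReal (treeProd G Λ w (fun x y => rho Q (ω y - ω x) (s y - s x)))

/-! ### The Gibbsian specification and gradient Gibbs measures -/

/-- The weight `Q(σ_x - σ_y)` of the edge `{x,y}`. The absolute value only serves to make the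
expression symmetric in `x` and `y`; it changes nothing when `Q` is even. -/
def edgeWeight (Q : ℤ → ℝ) (σ : V → ℤ) (b : Sym2 V) : ℝ :=
  Sym2.lift ⟨fun x y => Q |σ x - σ y|, fun x y => by simp only [abs_sub_comm]⟩ b

/-- The configuration equal to `τ` on `Λ` and to `ω` off `Λ`. -/
def glue (Λ : Finset V) (τ : Λ → ℤ) (ω : V → ℤ) : V → ℤ :=
  open Classical in
  fun x => if h : x ∈ Λ then τ ⟨x, h⟩ else ω x

/-- `∏_{b ∩ Λ ≠ ∅} Q_b(σ_b)`. -/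
def boltzmannWeight [G.LocallyFinite] (Q : ℤ → ℝ) (Λ : Finset V) (σ : V → ℤ) : ℝ :=
  open Classical in
  ∏ b ∈ Λ.biUnion (fun x => G.incidenceFinset x), edgeWeight Q σ b

/-- The partition function `Z_Λ(ω)`. -/
def partitionFunction [G.LocallyFinite] (Q : ℤ → ℝ) (Λ : Finset V) (ω : V → ℤ) : ℝ≥0∞ :=
  ∑' τ : Λ → ℤ, ENNReal.ofReal (boltzmannWeight G Q Λ (glue Λ τ ω))

/-- The kernel `γ_Λ(· | ω)` of the Gibbsian specification, a measure on height configurations. -/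
def gibbsKernel [G.LocallyFinite] (Q : ℤ → ℝ) (Λ : Finset V) (ω : V → ℤ) : Measure (V → ℤ) :=
  Measure.sum fun τ : Λ → ℤ =>
    (ENNReal.ofReal (boltzmannWeight G Q Λ (glue Λ τ ω)) / partitionFunction G Q Λ ω) •
      Measure.dirac (glue Λ τ ω)

/-- The gradient kernel `γ'_Λ(· | ζ)`: the image under `∇` of `γ_Λ(· | ω)`, where `ω` is any height
configuration with `∇ω = ζ`. (As the interaction depends on increments only, the choice of `ω`
is immaterial; configurations `ζ` that are not gradients get the zero measure.) -/
def gradientKernel [G.LocallyFinite] (Q : ℤ → ℝ) (Λ : Finset V) (ζ : G.Dart → ℤ) : Measure (G.Dart → ℤ) :=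
  open Classical in
  if h : ∃ ω : V → ℤ, grad G ω = ζ then (gibbsKernel G Q Λ h.choose).map (grad G) else 0

/-- `ν` is a gradient Gibbs measure: a probability measure, carried by gradient configurations,
that satisfies the DLR equation `ν γ'_Λ = ν` for every finite `Λ`. -/
structure IsGradientGibbsMeasure [G.LocallyFinite] (Q : ℤ → ℝ)
    (ν : Measure (G.Dart → ℤ)) : Prop where
  prob : IsProbabilityMeasure ν
  gradient : ∀ᵐ ζ ∂ν, ∃ ω : V → ℤ, grad G ω = ζ
  dlr : ∀ (Λ : Finset V) (A : Set (G.Dart → ℤ)), MeasurableSet A →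
    ∫⁻ ζ, gradientKernel G Q Λ ζ A ∂ν = ν A

/-- Invariance of a measure on edge increments under all automorphisms of the graph. -/
def IsAutomorphismInvariant (ν : Measure (G.Dart → ℤ)) : Prop :=
  ∀ g : G ≃g G, ν.map (fun η e => η (g.toHom.mapDart e)) = ν

/-- The normalization of `Q` to a probability measure on `ℤ`. -/
def incrementLaw (Q : ℤ → ℝ) : Measure ℤ :=
  Measure.sum fun j : ℤ => ENNReal.ofReal (Q j / ∑' i : ℤ, Q i) • Measure.dirac j

/-- The free state: the increments are i.i.d. over the edges, with law `Q` normalized. Each edge `b`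
carries one variable `X b`, read along an arbitrarily fixed orientation of `b` and with opposite
sign along the other one (`Q` being even, the orientation is immaterial). -/
def freeState (Q : ℤ → ℝ) : Measure (G.Dart → ℤ) :=
  open Classical in
  (Measure.infinitePi fun _ : G.edgeSet => incrementLaw Q).map
    fun X e => if e.toProd = Quot.out e.edge then X ⟨e.edge, e.edge_mem⟩
      else -X ⟨e.edge, e.edge_mem⟩

end Tree

end TreeGradient

end

noncomputable section

namespace TreeGradient

/-! ### Critical points of the quotient energy ^ (d + 1) / mass ^ (2d) on a finite index set -/

section Variational

/-! Write a boundary law as `lam = x ^ d`. Its equation becomes the finite system `∑_t Q_q(s - t)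
x(t)^d = θ x(s)` on `ZMod q`. Because the kernel is symmetric, this is the critical point equation
of the quotient `energy ^ (d + 1) / mass ^ (2 * d)`, which is homogeneous of degree zero. Positive
solutions are therefore found by maximizing over a compact set; what remains is to see that the
maximizer is not on a harmful boundary and is not constant.

In part 1 the maximum is taken over the box `x(0) = 1`, `0 ≤ x(s) ≤ ε` for `s ≠ 0`
(`exists_fixedPoint_of_box`). The inequality `δ + γ ε^d ≤ ε` makes the upper faces harmless, and the
second inequality of `goodSet` forces `ε < 1`, so the solution is not constant. In part 2 the
maximum is global (`exists_fixedPoint_of_isMax`). A point mass has quotient at least 1 and a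
constant vector has quotient `γ^(d+1) / q^(d-1)`, where `γ` is the sum of `Q`; hence for large `q`
no maximizer is constant (`exists_nonconstant_fixedPoint`).

Any non-constant boundary law then gives the required measure. The fuzzy chain and the increments
are built from independent variables along the tree seen from a root. Detailed balance makes the
result independent of the root, which yields automorphism invariance. The probability of a gradient
cylinder is a product of edge weights `Q` times a boundary factor (`gradientMeasure_gradCylinder`).
At a vertex whose neighbours are all present, the boundary law equation cancels its `lam` against
the normalizations of its `d` children, so the boundary factor does not see that vertex
(`boundaryWeight_congr`). This gives the DLR equation.

Finally, one increment has weight `Q(j)` times the autocorrelation of `lam` at `j`. In the free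
state the autocorrelation would not depend on `j`, which forces `lam` to be constant
(`gradientMeasure_ne_freeState`). -/

theorem nonpos_of_isMax_of_lt {h br c : ℝ → ℝ} {t b : ℝ} (ht : 0 ≤ t) (hb : t < b)
    (hbr : Continuous br) (hd : ∀ τ, HasDerivAt h (c τ * br τ) τ) (hc : ∀ τ, 0 < τ → 0 < c τ)
    (hmax : ∀ τ ∈ Set.Icc 0 b, h τ ≤ h t) : br t ≤ 0 := by
  by_contra! hpos
  obtain ⟨η, hη, hball⟩ := Metric.eventually_nhds_iff.1
    (hbr.continuousAt.eventually (lt_mem_nhds hpos))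
  set u := min b (t + η / 2) with hu
  have htu : t < u := lt_min hb (by linarith)
  have hmono : StrictMonoOn h (Set.Icc t u) := by
    refine strictMonoOn_of_deriv_pos (convex_Icc _ _)
      (fun x _ => (hd x).continuousAt.continuousWithinAt) fun x hx => ?_
    rw [interior_Icc] at hx
    rw [(hd x).deriv]
    refine mul_pos (hc x (ht.trans_lt hx.1)) (hball ?_)
    have : u ≤ t + η / 2 := min_le_right _ _
    rw [Real.dist_eq, abs_lt]
    constructor <;> linarith [hx.1, hx.2]
  exact absurd (hmono ⟨le_rfl, htu.le⟩ ⟨htu.le, le_rfl⟩ htu)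
    (hmax u ⟨by linarith, min_le_left _ _⟩).not_gt

/-- Together with the preceding lemma this is a one-sided derivative test for the bracket `br`: room
to the right of the maximum gives `br ≤ 0`, room to the left gives `br ≥ 0`. The factor `c` may
vanish at 0, so the derivative at 0 itself can carry no information; strict monotonicity on a
one-sided interval is used instead. -/
theorem nonneg_of_isMax_of_pos {h br c : ℝ → ℝ} {t b : ℝ} (ht : 0 < t) (hb : t ≤ b)
    (hbr : Continuous br) (hd : ∀ τ, HasDerivAt h (c τ * br τ) τ) (hc : ∀ τ, 0 < τ → 0 < c τ)
    (hmax : ∀ τ ∈ Set.Icc 0 b, h τ ≤ h t) : 0 ≤ br t := by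
  by_contra! hneg
  obtain ⟨η, hη, hball⟩ := Metric.eventually_nhds_iff.1
    (hbr.continuousAt.eventually (gt_mem_nhds hneg))
  set u := max 0 (t - η / 2) with hu
  have htu : u < t := max_lt ht (by linarith)
  have h0u : 0 ≤ u := le_max_left _ _
  have hanti : StrictAntiOn h (Set.Icc u t) := by
    refine strictAntiOn_of_deriv_neg (convex_Icc _ _)
      (fun x _ => (hd x).continuousAt.continuousWithinAt) fun x hx => ?_
    rw [interior_Icc] at hx
    rw [(hd x).deriv]
    refine mul_neg_of_pos_of_neg (hc x (h0u.trans_lt hx.1)) (hball ?_)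
    have : t - η / 2 ≤ u := le_max_right _ _
    rw [Real.dist_eq, abs_lt]
    constructor <;> linarith [hx.1, hx.2]
  exact absurd (hanti ⟨le_rfl, htu.le⟩ ⟨htu.le, le_rfl⟩ htu)
    (hmax u ⟨h0u, by linarith⟩).not_gt

variable {ι : Type*} [Fintype ι] [DecidableEq ι]

/-- The field `∑_t K(s,t) x(t)^d`. -/
def field (K : ι → ι → ℝ) (d : ℕ) (x : ι → ℝ) (s : ι) : ℝ := ∑ t, K s t * x t ^ d

/-- The energy `∑_{s,t} K(s,t) x(s)^d x(t)^d`. -/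
def energy (K : ι → ι → ℝ) (d : ℕ) (x : ι → ℝ) : ℝ := ∑ s, x s ^ d * field K d x s

/-- The mass `∑_s x(s)^{d+1}`. -/
def mass (d : ℕ) (x : ι → ℝ) : ℝ := ∑ s, x s ^ (d + 1)

theorem field_eq_add (K : ι → ι → ℝ) (d : ℕ) (x : ι → ℝ) (s u : ι) :
    field K d x u = K u s * x s ^ d + ∑ t ∈ Finset.univ.erase s, K u t * x t ^ d := by
  rw [field, Finset.add_sum_erase _ (fun t => K u t * x t ^ d) (Finset.mem_univ s)]

/-- Isolating one coordinate leaves a quadratic polynomial in `x s ^ d`; symmetry of `K` merges the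
two cross terms. The first order conditions thereby become one-variable calculus. -/
theorem energy_eq_quadratic {K : ι → ι → ℝ} (hK : ∀ s t, K s t = K t s) (d : ℕ) (x : ι → ℝ)
    (s : ι) :
    energy K d x = K s s * x s ^ (2 * d)
      + 2 * (∑ t ∈ Finset.univ.erase s, K s t * x t ^ d) * x s ^ d
      + ∑ u ∈ Finset.univ.erase s, x u ^ d * ∑ t ∈ Finset.univ.erase s, K u t * x t ^ d := by
  rw [energy, ← Finset.add_sum_erase _ _ (Finset.mem_univ s), field_eq_add K d x s s]
  have hsplit : ∑ u ∈ Finset.univ.erase s, x u ^ d * field K d x u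
      = ∑ u ∈ Finset.univ.erase s, x u ^ d * (K u s * x s ^ d)
        + ∑ u ∈ Finset.univ.erase s, x u ^ d * ∑ t ∈ Finset.univ.erase s, K u t * x t ^ d := by
    rw [← Finset.sum_add_distrib]
    exact Finset.sum_congr rfl fun u _ => by rw [field_eq_add K d x s u, mul_add]
  rw [hsplit]
  have : ∑ u ∈ Finset.univ.erase s, x u ^ d * (K u s * x s ^ d)
      = (∑ t ∈ Finset.univ.erase s, K s t * x t ^ d) * x s ^ d := by
    rw [Finset.sum_mul]
    exact Finset.sum_congr rfl fun u _ => by rw [hK u s]; ring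
  rw [this]
  ring

theorem mass_eq_add (d : ℕ) (x : ι → ℝ) (s : ι) :
    mass d x = x s ^ (d + 1) + ∑ t ∈ Finset.univ.erase s, x t ^ (d + 1) := by
  rw [mass, ← Finset.add_sum_erase _ _ (Finset.mem_univ s)]

/-- The first order conditions in one coordinate for a maximizer of
`energy ^ (d + 1) / mass ^ (2 * d)`. -/
theorem coordinate_conditions {K : ι → ι → ℝ} (hK : ∀ s t, K s t = K t s)
    (hpos : ∀ s t, 0 < K s t) {d : ℕ} (hd : 1 ≤ d) {x : ι → ℝ} (hx : ∀ t, 0 ≤ x t) {s t : ι}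
    (hts : t ≠ s) (ht : 0 < x t) {b : ℝ} (hb : 0 < b) (hsb : x s ≤ b)
    (hmax : ∀ τ ∈ Set.Icc 0 b,
      energy K d (Function.update x s τ) ^ (d + 1) * mass d x ^ (2 * d)
        ≤ energy K d x ^ (d + 1) * mass d (Function.update x s τ) ^ (2 * d)) :
    0 < x s ∧ energy K d x * x s ≤ mass d x * field K d x s ∧
      (x s < b → energy K d x * x s = mass d x * field K d x s) := by
  set A := K s s with hA
  set B := ∑ t ∈ Finset.univ.erase s, K s t * x t ^ d with hB
  set C := ∑ u ∈ Finset.univ.erase s, x u ^ d * ∑ t ∈ Finset.univ.erase s, K u t * x t ^ d with hC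
  set M := ∑ t ∈ Finset.univ.erase s, x t ^ (d + 1) with hM
  have htm : t ∈ Finset.univ.erase s := by simp [hts]
  have hB0 : 0 < B := Finset.sum_pos' (fun u _ => mul_nonneg (hpos _ _).le (pow_nonneg (hx u) _))
    ⟨t, htm, mul_pos (hpos _ _) (pow_pos ht _)⟩
  have hC0 : 0 < C := Finset.sum_pos'
    (fun u _ => mul_nonneg (pow_nonneg (hx u) _)
      (Finset.sum_nonneg fun v _ => mul_nonneg (hpos _ _).le (pow_nonneg (hx v) _)))
    ⟨t, htm, mul_pos (pow_pos ht _) (Finset.sum_pos'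
      (fun u _ => mul_nonneg (hpos _ _).le (pow_nonneg (hx u) _))
      ⟨t, htm, mul_pos (hpos _ _) (pow_pos ht _)⟩)⟩
  have hM0 : 0 < M := Finset.sum_pos' (fun u _ => pow_nonneg (hx u) _) ⟨t, htm, pow_pos ht _⟩
  have herase : ∀ τ, ∀ u ∈ Finset.univ.erase s, Function.update x s τ u = x u := fun τ u hu =>
    Function.update_of_ne (Finset.ne_of_mem_erase hu) _ _
  have hE : energy K d x = A * x s ^ (2 * d) + 2 * B * x s ^ d + C := energy_eq_quadratic hK d x s
  have hN : mass d x = x s ^ (d + 1) + M := mass_eq_add d x s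
  have hF : field K d x s = A * x s ^ d + B := field_eq_add K d x s s
  have hEτ : ∀ τ, energy K d (Function.update x s τ) = A * τ ^ (2 * d) + 2 * B * τ ^ d + C := by
    intro τ
    have e : ∀ u, ∑ t ∈ Finset.univ.erase s, K u t * Function.update x s τ t ^ d
        = ∑ t ∈ Finset.univ.erase s, K u t * x t ^ d := fun u =>
      Finset.sum_congr rfl fun t ht => by rw [herase τ t ht]
    have e' : ∑ u ∈ Finset.univ.erase s, Function.update x s τ u ^ d
        * ∑ t ∈ Finset.univ.erase s, K u t * Function.update x s τ t ^ d = C :=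
      Finset.sum_congr rfl fun u hu => by rw [e u, herase τ u hu]
    rw [energy_eq_quadratic hK d _ s, Function.update_self, e s, e']
  have hNτ : ∀ τ, mass d (Function.update x s τ) = τ ^ (d + 1) + M := by
    intro τ
    have e : ∑ u ∈ Finset.univ.erase s, Function.update x s τ u ^ (d + 1) = M :=
      Finset.sum_congr rfl fun u hu => by rw [herase τ u hu]
    rw [mass_eq_add d _ s, Function.update_self, e]
  set t₀ := x s with ht₀
  have ht₀0 : 0 ≤ t₀ := hx s
  set φ : ℝ → ℝ := fun τ => A * τ ^ (2 * d) + 2 * B * τ ^ d + C with hφ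
  set n : ℝ → ℝ := fun τ => τ ^ (d + 1) + M with hn
  have hA0 : 0 < A := hpos s s
  have hφ0 : 0 < φ t₀ := by simp only [hφ]; positivity
  have hn0 : 0 < n t₀ := by simp only [hn]; positivity
  -- The quotient inequality is kept in cross-multiplied form, so that `h` is a polynomial. Its
  -- derivative is `c * br`, where `c` collects the factor `τ ^ (d - 1)` common to both terms.
  set h : ℝ → ℝ := fun τ => φ τ ^ (d + 1) * n t₀ ^ (2 * d) - φ t₀ ^ (d + 1) * n τ ^ (2 * d) with hh
  set br : ℝ → ℝ := fun τ =>
    φ τ ^ d * (A * τ ^ d + B) * n t₀ ^ (2 * d) - φ t₀ ^ (d + 1) * n τ ^ (2 * d - 1) * τ with hbr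
  set c : ℝ → ℝ := fun τ => 2 * d * (d + 1) * τ ^ (d - 1) with hc
  have hcont : Continuous br := by simp only [hbr, hφ, hn]; fun_prop
  have hderiv : ∀ τ, HasDerivAt h (c τ * br τ) τ := by
    intro τ
    have h1 : HasDerivAt φ (A * ((2 * d : ℕ) * τ ^ (2 * d - 1)) + 2 * B * (d * τ ^ (d - 1))) τ :=
      (((hasDerivAt_pow (2 * d) τ).const_mul A).add ((hasDerivAt_pow d τ).const_mul (2 * B))).add_const C
    have h2 : HasDerivAt n ((d + 1 : ℕ) * τ ^ (d + 1 - 1)) τ := (hasDerivAt_pow (d + 1) τ).add_const M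
    have h3 := ((h1.pow (d + 1)).mul_const (n t₀ ^ (2 * d))).sub
      ((h2.pow (2 * d)).const_mul (φ t₀ ^ (d + 1)))
    refine h3.congr_deriv ?_
    obtain ⟨e, rfl⟩ : ∃ e, d = e + 1 := ⟨d - 1, by omega⟩
    simp only [hc, hbr, show 2 * (e + 1) - 1 = 2 * e + 1 by omega, Nat.add_sub_cancel]
    push_cast
    ring
  have hcpos : ∀ τ, 0 < τ → 0 < c τ := fun τ hτ => by
    have : (0 : ℝ) < d := by exact_mod_cast hd
    simp only [hc]; positivity
  have hh0 : h t₀ = 0 := by simp only [hh]; ring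
  have hmax' : ∀ τ ∈ Set.Icc 0 b, h τ ≤ h t₀ := by
    intro τ hτ
    have := hmax τ hτ
    rw [hEτ, hNτ, hE, hN] at this
    rw [hh0]
    simp only [hh, hφ, hn]
    linarith
  have hbr0 : br t₀ = φ t₀ ^ d * n t₀ ^ (2 * d - 1) * (n t₀ * (A * t₀ ^ d + B) - φ t₀ * t₀) := by
    simp only [hbr]
    have : n t₀ ^ (2 * d) = n t₀ ^ (2 * d - 1) * n t₀ := by
      rw [← pow_succ]; congr 1; omega
    rw [this]; ring
  have hfac : 0 < φ t₀ ^ d * n t₀ ^ (2 * d - 1) := by positivity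
  have hlow : t₀ < b → n t₀ * (A * t₀ ^ d + B) ≤ φ t₀ * t₀ := fun hlt => by
    have := nonpos_of_isMax_of_lt ht₀0 hlt hcont hderiv hcpos hmax'
    rw [hbr0] at this
    by_contra! hcon
    exact absurd (mul_pos hfac (sub_pos.2 hcon)) this.not_gt
  -- At `t₀ = 0` the lower condition would read `n t₀ * B ≤ 0`, but `B` contains a positive
  -- coordinate other than `s`. Thus the face `x s = 0` never carries the maximum.
  have hpos₀ : 0 < t₀ := by
    rcases ht₀0.lt_or_eq with h0 | h0
    · exact h0
    · exfalso
      have := hlow (h0 ▸ hb)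
      have h2 : t₀ ^ d = 0 := by rw [← h0]; exact zero_pow (by omega)
      rw [h2, show φ t₀ * t₀ = 0 by rw [← h0, mul_zero]] at this
      nlinarith [mul_pos hn0 hB0]
  have hup : φ t₀ * t₀ ≤ n t₀ * (A * t₀ ^ d + B) := by
    have := nonneg_of_isMax_of_pos hpos₀ hsb hcont hderiv hcpos hmax'
    rw [hbr0] at this
    by_contra! hcon
    exact absurd (mul_neg_of_pos_of_neg hfac (sub_neg.2 hcon)) this.not_gt
  rw [hE, hN, hF]
  exact ⟨hpos₀, hup, fun hlt => le_antisymm hup (hlow hlt)⟩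

end Variational

section Variational

variable {ι : Type*} [Fintype ι]

theorem continuous_energy (K : ι → ι → ℝ) (d : ℕ) : Continuous (energy K d) := by
  unfold energy field; fun_prop

theorem continuous_mass (d : ℕ) : Continuous (mass (ι := ι) d) := by
  unfold mass; fun_prop

theorem mass_pos {d : ℕ} {x : ι → ℝ} (hx : ∀ t, 0 ≤ x t) {s : ι} (hs : 0 < x s) :
    0 < mass d x :=
  Finset.sum_pos' (fun _ _ => pow_nonneg (hx _) _) ⟨s, Finset.mem_univ _, pow_pos hs _⟩

theorem field_pos {K : ι → ι → ℝ} (hpos : ∀ s t, 0 < K s t) {d : ℕ} {x : ι → ℝ}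
    (hx : ∀ t, 0 ≤ x t) {s : ι} (hs : 0 < x s) (u : ι) : 0 < field K d x u :=
  Finset.sum_pos' (fun _ _ => mul_nonneg (hpos _ _).le (pow_nonneg (hx _) _))
    ⟨s, Finset.mem_univ _, mul_pos (hpos _ _) (pow_pos hs _)⟩

theorem energy_pos {K : ι → ι → ℝ} (hpos : ∀ s t, 0 < K s t) {d : ℕ} {x : ι → ℝ}
    (hx : ∀ t, 0 ≤ x t) {s : ι} (hs : 0 < x s) : 0 < energy K d x :=
  Finset.sum_pos' (fun u _ => mul_nonneg (pow_nonneg (hx _) _) (field_pos hpos hx hs u).le)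
    ⟨s, Finset.mem_univ _, mul_pos (pow_pos hs _) (field_pos hpos hx hs s)⟩

/-- On a compact set on which the mass is positive, `energy ^ (d + 1) / mass ^ (2 * d)` attains its
maximum. -/
theorem exists_isMax_energy (K : ι → ι → ℝ) (d : ℕ) {S : Set (ι → ℝ)} (hS : IsCompact S)
    (hne : S.Nonempty) (hm : ∀ x ∈ S, 0 < mass d x) :
    ∃ x ∈ S, ∀ y ∈ S,
      energy K d y ^ (d + 1) * mass d x ^ (2 * d) ≤ energy K d x ^ (d + 1) * mass d y ^ (2 * d) := by
  obtain ⟨x, hx, hmax⟩ := hS.exists_isMaxOn hne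
    (f := fun x => energy K d x ^ (d + 1) / mass d x ^ (2 * d))
    ((((continuous_energy K d).pow _).continuousOn).div
      (((continuous_mass d).pow _).continuousOn) fun x hx => (pow_pos (hm x hx) _).ne')
  refine ⟨x, hx, fun y hy => ?_⟩
  have := hmax hy
  rwa [Set.mem_ofPred_eq, div_le_div_iff₀ (pow_pos (hm y hy) _) (pow_pos (hm x hx) _)] at this

variable [DecidableEq ι]

/-- A maximizer in the box `x o = 1`, `0 ≤ x ≤ ε` off `o` is a fixed point. -/
theorem exists_fixedPoint_of_box {K : ι → ι → ℝ} (hK : ∀ s t, K s t = K t s)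
    (hpos : ∀ s t, 0 < K s t) {d : ℕ} (hd : 1 ≤ d) (o : ι) {γ δ ε : ℝ} (hε : 0 < ε)
    (hoo : 1 ≤ K o o) (hδ : ∀ s, s ≠ o → K s o ≤ δ) (hγ : ∀ s, ∑ t, K s t ≤ γ)
    (hbox : δ + γ * ε ^ d ≤ ε) :
    ∃ (x : ι → ℝ) (θ : ℝ), 0 < θ ∧ (∀ s, 0 < x s) ∧ x o = 1 ∧ (∀ s, s ≠ o → x s ≤ ε) ∧
      ∀ s, field K d x s = θ * x s := by
  set S : Set (ι → ℝ) := Set.univ.pi fun s => if s = o then {1} else Set.Icc 0 ε with hSdef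
  have hS : IsCompact S := isCompact_univ_pi fun s => by
    split_ifs
    exacts [isCompact_singleton, isCompact_Icc]
  have hmem : ∀ x, x ∈ S ↔ x o = 1 ∧ ∀ s, s ≠ o → x s ∈ Set.Icc 0 ε := by
    intro x
    simp only [hSdef, Set.mem_univ_pi]
    refine ⟨fun h => ⟨by simpa using h o, fun s hs => by simpa [hs] using h s⟩, fun h s => ?_⟩
    split_ifs with hs
    · rw [hs]; exact h.1
    · exact h.2 s hs
  have hnn : ∀ x ∈ S, ∀ s, 0 ≤ x s := by
    intro x hx s
    rw [hmem] at hx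
    by_cases hs : s = o
    · rw [hs, hx.1]; exact zero_le_one
    · exact (hx.2 s hs).1
  have hone : ∀ x ∈ S, 0 < x o := fun x hx => by rw [((hmem x).1 hx).1]; exact one_pos
  obtain ⟨x, hxS, hmax⟩ := exists_isMax_energy K d hS
    ⟨fun s => if s = o then 1 else 0, (hmem _).2 ⟨by simp, fun s hs => by simp [hs, hε.le]⟩⟩
    fun x hx => mass_pos (hnn x hx) (hone x hx)
  have hx0 := hnn x hxS
  have hxo := ((hmem x).1 hxS).1
  have hxs := ((hmem x).1 hxS).2
  have hN : 0 < mass d x := mass_pos hx0 (hone x hxS)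
  have hE : 0 < energy K d x := energy_pos hpos hx0 (hone x hxS)
  have hcoord : ∀ s, s ≠ o → 0 < x s ∧ energy K d x * x s ≤ mass d x * field K d x s ∧
      (x s < ε → energy K d x * x s = mass d x * field K d x s) := by
    intro s hs
    refine coordinate_conditions hK hpos hd hx0 (Ne.symm hs) (hone x hxS) hε (hxs s hs).2
      fun τ hτ => hmax _ ((hmem _).2 ⟨?_, fun u hu => ?_⟩)
    · rw [Function.update_of_ne (Ne.symm hs), hxo]
    · by_cases hus : u = s
      · rw [hus, Function.update_self]; exact hτ
      · rw [Function.update_of_ne hus]; exact hxs u hu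
  have hEo : energy K d x = field K d x o + ∑ s ∈ Finset.univ.erase o, x s ^ d * field K d x s := by
    rw [energy, ← Finset.add_sum_erase _ _ (Finset.mem_univ o), hxo, one_pow, one_mul]
  have hNo : mass d x = 1 + ∑ s ∈ Finset.univ.erase o, x s ^ (d + 1) := by
    rw [mass_eq_add d x o, hxo, one_pow]
  -- Energy and mass are sums of `x s ^ d` times the field and `x s ^ d` times `x s`. Weighting the
  -- inequalities at `s ≠ o` by `x s ^ d` and summing gives the opposite inequality at the pinned
  -- coordinate `o`.
  have hko : mass d x * field K d x o ≤ energy K d x := by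
    have h1 : energy K d x * ∑ s ∈ Finset.univ.erase o, x s ^ (d + 1)
        ≤ mass d x * ∑ s ∈ Finset.univ.erase o, x s ^ d * field K d x s := by
      rw [Finset.mul_sum, Finset.mul_sum]
      refine Finset.sum_le_sum fun s hs => ?_
      have := mul_le_mul_of_nonneg_left (hcoord s (Finset.ne_of_mem_erase hs)).2.1
        (pow_nonneg (hx0 s) d)
      calc _ = x s ^ d * (energy K d x * x s) := by ring
        _ ≤ _ := this
        _ = _ := by ring
    have h2 : mass d x * energy K d x = mass d x * (field K d x o +
        ∑ s ∈ Finset.univ.erase o, x s ^ d * field K d x s) := by rw [← hEo]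
    have h3 : energy K d x * mass d x = energy K d x * (1 +
        ∑ s ∈ Finset.univ.erase o, x s ^ (d + 1)) := by rw [← hNo]
    linarith
  have hfo : 1 ≤ field K d x o := by
    rw [field_eq_add K d x o o, hxo, one_pow, mul_one]
    have : 0 ≤ ∑ t ∈ Finset.univ.erase o, K o t * x t ^ d :=
      Finset.sum_nonneg fun t _ => mul_nonneg (hpos _ _).le (pow_nonneg (hx0 t) _)
    linarith
  have hfs : ∀ s, s ≠ o → field K d x s ≤ ε := by
    intro s hs
    have h1 : ∑ t ∈ Finset.univ.erase o, K s t * x t ^ d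
        ≤ ∑ t ∈ Finset.univ.erase o, K s t * ε ^ d :=
      Finset.sum_le_sum fun t ht => by
        have := hxs t (Finset.ne_of_mem_erase ht)
        have := hpos s t
        gcongr
        exacts [hx0 t, (hxs t (Finset.ne_of_mem_erase ht)).2]
    have h2 : ∑ t ∈ Finset.univ.erase o, K s t ≤ γ :=
      (Finset.sum_le_sum_of_subset_of_nonneg (Finset.erase_subset _ _)
        fun t _ _ => (hpos s t).le).trans (hγ s)
    rw [← Finset.sum_mul] at h1
    rw [field_eq_add K d x o s, hxo, one_pow, mul_one]
    have h3 := mul_le_mul_of_nonneg_right h2 (pow_pos hε d).le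
    linarith [hδ s hs]
  -- On the upper face `x s = ε`, the chain `mass * field s ≤ mass * ε ≤ ε * mass * field o ≤ ε *
  -- energy` supplies the missing direction. The constraint `x s ≤ ε` is thus not felt.
  have heq : ∀ s, s ≠ o → energy K d x * x s = mass d x * field K d x s := by
    intro s hs
    rcases (hxs s hs).2.lt_or_eq with hlt | heq
    · exact (hcoord s hs).2.2 hlt
    · refine le_antisymm (hcoord s hs).2.1 ?_
      have h1 : mass d x * field K d x s ≤ mass d x * ε :=
        mul_le_mul_of_nonneg_left (hfs s hs) hN.le
      have h2 : mass d x * 1 ≤ mass d x * field K d x o := mul_le_mul_of_nonneg_left hfo hN.le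
      rw [heq]
      nlinarith
  -- With equality at every `s ≠ o`, the same weighted sum gives equality at `o`, although this
  -- coordinate was never varied.
  have heqo : energy K d x = mass d x * field K d x o := by
    have h1 : energy K d x * ∑ s ∈ Finset.univ.erase o, x s ^ (d + 1)
        = mass d x * ∑ s ∈ Finset.univ.erase o, x s ^ d * field K d x s := by
      rw [Finset.mul_sum, Finset.mul_sum]
      refine Finset.sum_congr rfl fun s hs => ?_
      calc _ = x s ^ d * (energy K d x * x s) := by ring
        _ = _ := by rw [heq s (Finset.ne_of_mem_erase hs)]; ring
    have h2 : mass d x * energy K d x = mass d x * (field K d x o +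
        ∑ s ∈ Finset.univ.erase o, x s ^ d * field K d x s) := by rw [← hEo]
    have h3 : energy K d x * mass d x = energy K d x * (1 +
        ∑ s ∈ Finset.univ.erase o, x s ^ (d + 1)) := by rw [← hNo]
    linarith
  refine ⟨x, energy K d x / mass d x, div_pos hE hN, fun s => ?_, hxo, fun s hs => (hxs s hs).2,
    fun s => ?_⟩
  · by_cases hs : s = o
    · rw [hs]; exact hone x hxS
    · exact (hcoord s hs).1
  · rw [div_mul_eq_mul_div, eq_div_iff hN.ne']
    by_cases hs : s = o
    · rw [hs, hxo, mul_one, heqo, mul_comm]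
    · rw [heq s hs, mul_comm]

/-- A global maximizer is a fixed point. -/
theorem exists_fixedPoint_of_isMax [Nontrivial ι] {K : ι → ι → ℝ} (hK : ∀ s t, K s t = K t s)
    (hpos : ∀ s t, 0 < K s t) {d : ℕ} (hd : 1 ≤ d) :
    ∃ (x : ι → ℝ) (θ : ℝ), 0 < θ ∧ (∀ s, 0 < x s) ∧ (∀ s, field K d x s = θ * x s) ∧
      ∀ y : ι → ℝ, (∀ s, 0 ≤ y s) → ∀ s, 0 < y s →
        energy K d y ^ (d + 1) * mass d x ^ (2 * d)
          ≤ energy K d x ^ (d + 1) * mass d y ^ (2 * d) := by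
  have hex : ∀ x ∈ stdSimplex ℝ ι, ∃ s, 0 < x s := by
    intro x hx
    by_contra! h
    have : ∑ s, x s ≤ 0 := Finset.sum_nonpos fun s _ => h s
    rw [hx.2] at this
    linarith
  obtain ⟨x, hxS, hmax'⟩ := exists_isMax_energy K d (isCompact_stdSimplex ℝ ι)
    ⟨_, single_mem_stdSimplex ℝ (Classical.arbitrary ι)⟩
    fun x hx => (hex x hx).elim fun s hs => mass_pos hx.1 hs
  -- Homogeneity of degree zero extends maximality from the simplex to all nonzero nonnegative
  -- vectors.
  have hmax : ∀ y : ι → ℝ, (∀ s, 0 ≤ y s) → ∀ s, 0 < y s →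
        energy K d y ^ (d + 1) * mass d x ^ (2 * d)
          ≤ energy K d x ^ (d + 1) * mass d y ^ (2 * d) := by
    intro y hy s hs
    have ht : 0 < ∑ s, y s := Finset.sum_pos' (fun s _ => hy s) ⟨s, Finset.mem_univ _, hs⟩
    set r := (∑ s, y s)⁻¹ with hr
    have hr0 : 0 < r := inv_pos.2 ht
    have h := hmax' (fun s => r * y s) ⟨fun s => mul_nonneg hr0.le (hy s), by
      rw [← Finset.mul_sum, hr, inv_mul_cancel₀ ht.ne']⟩
    have hE : energy K d (fun s => r * y s) = r ^ (2 * d) * energy K d y := by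
      simp only [energy, field, Finset.mul_sum]
      refine Finset.sum_congr rfl fun _ _ => Finset.sum_congr rfl fun _ _ => by ring
    have hM : mass d (fun s => r * y s) = r ^ (d + 1) * mass d y := by
      simp only [mass, Finset.mul_sum]
      refine Finset.sum_congr rfl fun _ _ => by ring
    rw [hE, hM] at h
    have hr1 : 0 < (r ^ (2 * d)) ^ (d + 1) := by positivity
    refine le_of_mul_le_mul_left ?_ hr1
    calc _ = (r ^ (2 * d) * energy K d y) ^ (d + 1) * mass d x ^ (2 * d) := by ring
      _ ≤ _ := h
      _ = _ := by rw [mul_pow (r ^ (d + 1)), ← pow_mul, ← pow_mul, mul_comm (d + 1)]; ring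
  have hx0 := hxS.1
  have hcoord : ∀ s t, t ≠ s → 0 < x t →
      0 < x s ∧ energy K d x * x s = mass d x * field K d x s := by
    intro s t hts ht
    -- There is no upper constraint here. Any bound above `x s` will do, and the equality case of
    -- `coordinate_conditions` applies.
    obtain ⟨h1, -, h3⟩ := coordinate_conditions hK hpos hd hx0 hts ht (b := x s + 1)
      (by linarith [hx0 s]) (by linarith) fun τ hτ => by
        refine hmax _ (fun u => ?_) t (by rwa [Function.update_of_ne hts])
        by_cases hus : u = s
        · rw [hus, Function.update_self]; exact hτ.1
        · rw [Function.update_of_ne hus]; exact hx0 u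
    exact ⟨h1, h3 (by linarith)⟩
  obtain ⟨s₀, hs₀⟩ := hex x hxS
  have hxpos : ∀ s, 0 < x s := fun s => by
    by_cases hs : s = s₀
    · rw [hs]; exact hs₀
    · exact (hcoord s s₀ (Ne.symm hs) hs₀).1
  have hN : 0 < mass d x := mass_pos hx0 hs₀
  refine ⟨x, energy K d x / mass d x, div_pos (energy_pos hpos hx0 hs₀) hN, hxpos, fun s => ?_, hmax⟩
  obtain ⟨t, ht⟩ := exists_ne s
  rw [div_mul_eq_mul_div, eq_div_iff hN.ne', (hcoord s t ht (hxpos t)).2, mul_comm]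

/-- A fixed point which is not constant. -/
theorem exists_nonconstant_fixedPoint [Nontrivial ι] {K : ι → ι → ℝ} (hK : ∀ s t, K s t = K t s)
    (hpos : ∀ s t, 0 < K s t) {d : ℕ} (hd : 1 ≤ d) (o : ι) {γ : ℝ} (hoo : 1 ≤ K o o)
    (hγ : ∀ s, ∑ t, K s t = γ) (hcard : γ ^ (d + 1) < (Fintype.card ι : ℝ) ^ (d - 1)) :
    ∃ (x : ι → ℝ) (θ : ℝ), 0 < θ ∧ (∀ s, 0 < x s) ∧ (∃ s t, x s ≠ x t) ∧
      ∀ s, field K d x s = θ * x s := by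
  obtain ⟨x, θ, hθ, hx, hfix, hmax⟩ := exists_fixedPoint_of_isMax hK hpos hd
  refine ⟨x, θ, hθ, hx, ?_, hfix⟩
  by_contra! hconst
  set a := x o with ha
  have hxa : ∀ s, x s = a := fun s => hconst s o
  have ha0 : 0 < a := hx o
  set n : ℝ := (Fintype.card ι : ℝ) with hn
  have hn0 : 0 < n := by rw [hn]; exact_mod_cast Fintype.card_pos
  have hE : energy K d x = n * (a ^ d * (γ * a ^ d)) := by
    simp [energy, field, hxa, ← Finset.sum_mul, hγ, hn]
  have hM : mass d x = n * a ^ (d + 1) := by simp [mass, hxa, hn]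
  -- The competitor is the point mass at `o`, with quotient `K o o ^ (d + 1) ≥ 1`. A constant vector
  -- has quotient `γ ^ (d + 1) / n ^ (d - 1)`, which is below 1 by `hcard`.
  have h := hmax (Pi.single o 1) (fun s => by
    by_cases hs : s = o
    · rw [hs]; simp
    · simp [hs]) o (by simp)
  have h0 : ∀ t, t ≠ o → (Pi.single o (1 : ℝ) : ι → ℝ) t = 0 := fun t ht => by simp [ht]
  have hE1 : energy K d (Pi.single o (1 : ℝ)) = K o o := by
    rw [energy, Finset.sum_eq_single o, field, Finset.sum_eq_single o]
    · simp
    · intro t _ ht; rw [h0 t ht, zero_pow (by omega), mul_zero]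
    · simp
    · intro t _ ht; rw [h0 t ht, zero_pow (by omega), zero_mul]
    · simp
  have hM1 : mass d (Pi.single o (1 : ℝ) : ι → ℝ) = 1 := by
    rw [mass, Finset.sum_eq_single o]
    · simp
    · intro t _ ht; rw [h0 t ht, zero_pow (by omega)]
    · simp
  rw [hE1, hM1, hE, hM, one_pow, mul_one] at h
  have h1 : (n * a ^ (d + 1)) ^ (2 * d) ≤ K o o ^ (d + 1) * (n * a ^ (d + 1)) ^ (2 * d) :=
    le_mul_of_one_le_left (by positivity) (one_le_pow₀ hoo)
  have h2 : (n * a ^ (d + 1)) ^ (2 * d) = n ^ (d - 1) * (n ^ (d + 1) * a ^ (2 * d * (d + 1))) := by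
    rw [mul_pow, ← pow_mul, ← mul_assoc (n ^ (d - 1)), ← pow_add,
      show d - 1 + (d + 1) = 2 * d by omega, show (d + 1) * (2 * d) = 2 * d * (d + 1) by ring]
  have h3 : (n * (a ^ d * (γ * a ^ d))) ^ (d + 1)
      = γ ^ (d + 1) * (n ^ (d + 1) * a ^ (2 * d * (d + 1))) := by
    ring
  rw [h3] at h
  have h4 := h1.trans h
  rw [h2] at h4
  exact absurd (le_of_mul_le_mul_right h4 (by positivity)) hcard.not_ge

end Variational

/-! ### From fixed points to periodic boundary laws -/

section BoundaryLaw

variable {Q : ℤ → ℝ} {q : ℕ}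

/-- Sums of `Q` against a periodic function are sums over residue classes. -/
theorem hasSum_mul_periodic [NeZero q] (hQ : Summable Q) (lam : ZMod q → ℝ) (s : ZMod q) :
    HasSum (fun j : ℤ => Q j * lam (s - j)) (∑ u : ZMod q, fuzzyQ Q (s - u) * lam u) := by
  have hsum : Summable fun j : ℤ => Q j * lam (s - j) := by
    refine Summable.of_norm_bounded (hQ.abs.mul_right (∑ u, |lam u|)) fun j => ?_
    rw [norm_mul, Real.norm_eq_abs, Real.norm_eq_abs]
    exact mul_le_mul_of_nonneg_left
      (Finset.single_le_sum (f := fun u => |lam u|) (fun u _ => abs_nonneg _) (Finset.mem_univ _))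
      (abs_nonneg _)
  have h := hsum.hasSum.tsum_fiberwise (fun j : ℤ => (j : ZMod q))
  have hfib : ∀ c : ZMod q, ∑' j : (fun j : ℤ => (j : ZMod q)) ⁻¹' {c}, Q j * lam (s - (j : ℤ))
      = fuzzyQ Q c * lam (s - c) := by
    intro c
    rw [fuzzyQ, ← tsum_mul_right]
    refine tsum_congr fun j => ?_
    have : ((j : ℤ) : ZMod q) = c := j.2
    rw [this]
  simp only [hfib] at h
  have h2 : ∑ u : ZMod q, fuzzyQ Q (s - u) * lam u = ∑ c, fuzzyQ Q c * lam (s - c) :=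
    Fintype.sum_equiv (Equiv.subLeft s) _ _ fun u => by simp
  rw [h2, (hasSum_fintype fun c => fuzzyQ Q c * lam (s - c)).unique h]
  exact hsum.hasSum

theorem hasSum_fuzzyQ [NeZero q] (hQ : Summable Q) :
    HasSum Q (∑ u : ZMod q, fuzzyQ Q u) := by
  have := hasSum_mul_periodic (q := q) hQ (fun _ => 1) 0
  simp only [mul_one] at this
  rwa [Fintype.sum_equiv (Equiv.subLeft (0 : ZMod q)) _ (fun u => fuzzyQ Q u) fun u => by simp]
    at this

theorem summable_fibre (hQ : Summable Q) (s : ZMod q) :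
    Summable fun l : {l : ℤ // (l : ZMod q) = s} => Q l :=
  hQ.comp_injective Subtype.val_injective

theorem le_fuzzyQ (hQ : Summable Q) (hpos : ∀ i, 0 ≤ Q i) {l : ℤ} {s : ZMod q}
    (hl : (l : ZMod q) = s) : Q l ≤ fuzzyQ Q s :=
  (summable_fibre hQ s).le_tsum ⟨l, hl⟩ fun l _ => hpos l

theorem fuzzyQ_pos (hQ : Summable Q) (hpos : ∀ i, 0 < Q i) (s : ZMod q) :
    0 < fuzzyQ Q s := by
  obtain ⟨l, rfl⟩ := ZMod.intCast_surjective s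
  exact (hpos l).trans_le (le_fuzzyQ hQ (fun i => (hpos i).le) rfl)

theorem fuzzyQ_neg (heven : ∀ i, Q (-i) = Q i) (s : ZMod q) : fuzzyQ Q (-s) = fuzzyQ Q s := by
  let e : {l : ℤ // (l : ZMod q) = -s} ≃ {l : ℤ // (l : ZMod q) = s} :=
    (Equiv.neg ℤ).subtypeEquiv fun l => by simp [neg_eq_iff_eq_neg]
  rw [fuzzyQ, fuzzyQ, ← e.tsum_eq fun l => Q l]
  exact tsum_congr fun l => (heven l).symm

theorem tsum_sub_mul_periodic [NeZero q] (hQ : Summable Q) (lam : ZMod q → ℝ) (i : ℤ) :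
    ∑' j : ℤ, Q (i - j) * lam (j : ZMod q)
      = ∑ u : ZMod q, fuzzyQ Q ((i : ZMod q) - u) * lam u := by
  rw [← (hasSum_mul_periodic hQ lam (i : ZMod q)).tsum_eq,
    ← (Equiv.subLeft i).tsum_eq fun j : ℤ => Q j * lam ((i : ZMod q) - j)]
  exact tsum_congr fun j => by simp

/-- A positive solution of the fixed point equation gives a boundary law. -/
theorem isPeriodicBoundaryLaw_of_field [NeZero q] (hQ : Summable Q) {d : ℕ} {x : ZMod q → ℝ}
    {θ : ℝ} (hθ : 0 < θ) (hx : ∀ s, 0 < x s)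
    (hfix : ∀ s, field (fun s t => fuzzyQ Q (s - t)) d x s = θ * x s) :
    IsPeriodicBoundaryLaw Q d fun s => x s ^ d where
  pos s := pow_pos (hx s) d
  eqn := by
    -- The sum in the boundary law equation is `θ * x i`, and its `d`-th power is `θ ^ d` times the
    -- boundary law.
    refine ⟨(θ ^ d)⁻¹, by positivity, fun i => ?_⟩
    have h2 : ∑' j : ℤ, Q (i - j) * x (j : ZMod q) ^ d = θ * x i := by
      rw [← hfix, field]
      exact tsum_sub_mul_periodic hQ (fun s => x s ^ d) i
    rw [h2, mul_pow, inv_mul_cancel_left₀ (by positivity)]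

/-- A non-constant boundary law in the contraction regime. -/
theorem exists_boundaryLaw_of_mem_goodSet {d : ℕ} (hd : 2 ≤ d)
    (heven : ∀ i, Q (-i) = Q i) (hpos : ∀ i, 0 < Q i) (hzero : Q 0 = 1) (hQ : Summable Q)
    (hgood : (pNorm 1 Q, pNormOffZero 1 Q) ∈ goodSet d) [NeZero q] (hq : 2 ≤ q) :
    ∃ lam : ZMod q → ℝ, IsPeriodicBoundaryLaw Q d lam ∧ ∃ s t, lam s ≠ lam t := by
  obtain ⟨hγ1, hδ, ε, hε, hbox, hlip⟩ := hgood
  simp only at hγ1 hδ hbox hlip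
  have hon : pNorm 1 Q = ∑' i, Q i := by simp [pNorm, abs_of_pos (hpos _)]
  have hoff : pNormOffZero 1 Q = ∑' j : {j : ℤ // j ≠ 0}, Q j := by
    simp [pNormOffZero, pNorm, abs_of_pos (hpos _)]
  rw [hon] at hγ1 hbox hlip
  rw [hoff] at hδ hbox hlip
  have hsplit : 1 ≤ fuzzyQ Q (0 : ZMod q) := by
    rw [← hzero]
    exact le_fuzzyQ hQ (fun i => (hpos i).le) (by simp)
  have hfield : ∀ s : ZMod q, s ≠ 0 → fuzzyQ Q s ≤ ∑' j : {j : ℤ // j ≠ 0}, Q j := by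
    intro s hs
    refine Summable.tsum_le_tsum_of_inj
      (fun l : {l : ℤ // (l : ZMod q) = s} => (⟨l, fun h => hs (by rw [← l.2, h]; simp)⟩ : {j : ℤ // j ≠ 0}))
      (fun a b h => Subtype.ext (by simpa using h)) (fun c _ => (hpos c).le) (fun l => le_rfl)
      (hQ.subtype _) (hQ.subtype _)
  have hsumrow : ∀ s : ZMod q, ∑ t, fuzzyQ Q (s - t) = ∑' i, Q i := fun s => by
    rw [(hasSum_fuzzyQ (q := q) hQ).tsum_eq]
    exact Fintype.sum_equiv (Equiv.subLeft s) _ _ fun u => by simp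
  have hd1 : (1 : ℝ) ≤ d := by exact_mod_cast (by omega : 1 ≤ d)
  -- If `ε ≥ 1`, the term `2 * d * γ * ε ^ (d - 1)` alone exceeds 1. The bound `ε < 1` is what
  -- separates the value at 1, at most `ε`, from the value 1 at the class 0.
  have hε1 : ε < 1 := by
    by_contra! h1
    have h2 : (1 : ℝ) ≤ ε ^ (d - 1) := one_le_pow₀ h1
    have h3 : 0 ≤ 2 * d * (∑' j : {j : ℤ // j ≠ 0}, Q j) * ε ^ d :=
      mul_nonneg (mul_nonneg (by positivity) hδ.le) (by positivity)
    have h4 : (1 : ℝ) ≤ d * ∑' i, Q i := by nlinarith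
    have h5 : (1 : ℝ) ≤ (d * ∑' i, Q i) * ε ^ (d - 1) := by nlinarith
    have h6 : 2 * d * (∑' i, Q i) * ε ^ (d - 1) = 2 * ((d * ∑' i, Q i) * ε ^ (d - 1)) := by ring
    linarith
  obtain ⟨x, θ, hθ, hx, hx0, hxε, hfix⟩ := exists_fixedPoint_of_box
    (K := fun s t : ZMod q => fuzzyQ Q (s - t)) (d := d)
    (fun s t => by rw [← neg_sub, fuzzyQ_neg heven]) (fun s t => fuzzyQ_pos hQ hpos _)
    (by omega) 0 hε (by simpa using hsplit) (fun s hs => by rw [sub_zero]; exact hfield s hs)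
    (fun s => (hsumrow s).le) hbox
  refine ⟨_, isPeriodicBoundaryLaw_of_field hQ hθ hx hfix, 1, 0, ?_⟩
  have : Fact (1 < q) := ⟨hq⟩
  have h1 := hxε 1 one_ne_zero
  rw [hx0, one_pow]
  exact (pow_lt_one₀ (hx 1).le (by linarith) (by omega)).ne

/-- A non-constant boundary law for all large periods. -/
theorem exists_boundaryLaw_of_large {d : ℕ} (hd : 2 ≤ d)
    (heven : ∀ i, Q (-i) = Q i) (hpos : ∀ i, 0 < Q i) (hzero : Q 0 = 1) (hQ : Summable Q)
    [NeZero q] (hq : 2 ≤ q) (hlarge : (∑' i, Q i) ^ (d + 1) < q) :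
    ∃ lam : ZMod q → ℝ, IsPeriodicBoundaryLaw Q d lam ∧ ∃ s t, lam s ≠ lam t := by
  have : Fact (1 < q) := ⟨hq⟩
  have hsplit : 1 ≤ fuzzyQ Q (0 : ZMod q) := by
    rw [← hzero]
    exact le_fuzzyQ hQ (fun i => (hpos i).le) (by simp)
  have hsumrow : ∀ s : ZMod q, ∑ t, fuzzyQ Q (s - t) = ∑' i, Q i := fun s => by
    rw [(hasSum_fuzzyQ (q := q) hQ).tsum_eq]
    exact Fintype.sum_equiv (Equiv.subLeft s) _ _ fun u => by simp
  obtain ⟨x, θ, hθ, hx, ⟨s, t, hst⟩, hfix⟩ := exists_nonconstant_fixedPoint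
    (K := fun s t : ZMod q => fuzzyQ Q (s - t)) (d := d)
    (fun s t => by rw [← neg_sub, fuzzyQ_neg heven]) (fun s t => fuzzyQ_pos hQ hpos _)
    (by omega) 0 (by simpa using hsplit) hsumrow (by
      rw [ZMod.card]
      have : (1 : ℝ) ≤ q := by exact_mod_cast (by omega : 1 ≤ q)
      -- Here `d ≥ 2` enters: the exponent `d - 1` is nonzero, so `q ≤ q ^ (d - 1)`.
      exact hlarge.trans_le (le_self_pow₀ this (by omega)))
  refine ⟨_, isPeriodicBoundaryLaw_of_field hQ hθ hx hfix, s, t, fun h => hst ?_⟩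
  exact (pow_left_inj₀ (hx s).le (hx t).le (by omega)).1 h

end BoundaryLaw

/-! ### Rooted trees: parents, recursion, products over edges -/

section TreeCombinatorics

variable {V : Type*} {G : SimpleGraph V}

open Classical in
/-- The parent of `v` in the graph rooted at `w` (and `w` itself for `v = w`). -/
def parent (G : SimpleGraph V) (w v : V) : V :=
  if h : ∃ u, G.Adj u v ∧ G.dist w v = G.dist w u + 1 then h.choose else v

theorem parent_root (w : V) : parent G w w = w := by
  rw [parent, dif_neg]
  rintro ⟨u, -, h⟩
  simp at h

theorem exists_parent (hG : G.IsTree) {w v : V} (hv : v ≠ w) :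
    ∃ u, G.Adj u v ∧ G.dist w v = G.dist w u + 1 := by
  obtain ⟨p, hp⟩ := hG.connected.exists_walk_length_eq_dist v w
  cases p with
  | nil => exact absurd rfl hv
  | @cons _ u _ h p =>
    refine ⟨u, h.symm, ?_⟩
    rw [SimpleGraph.Walk.length_cons] at hp
    have h1 := G.dist_le p
    have h2 := hG.dist_eq_dist_add_one_of_adj w h
    rw [G.dist_comm (u := w) (v := v), G.dist_comm (u := w) (v := u)] at *
    omega

theorem adj_parent (hG : G.IsTree) {w v : V} (hv : v ≠ w) : G.Adj (parent G w v) v := by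
  rw [parent, dif_pos (exists_parent hG hv)]
  exact (exists_parent hG hv).choose_spec.1

theorem dist_parent (hG : G.IsTree) {w v : V} (hv : v ≠ w) :
    G.dist w v = G.dist w (parent G w v) + 1 := by
  rw [parent, dif_pos (exists_parent hG hv)]
  exact (exists_parent hG hv).choose_spec.2

/-- The second vertex of a path to the root is the neighbour one step closer to the root. -/
theorem snd_eq_of_isPath (hG : G.IsTree) {w u v : V} (huv : G.Adj u v)
    (hd : G.dist w v = G.dist w u + 1) {p : G.Walk v w} (hp : p.IsPath) : p.snd = u := by
  obtain ⟨p', hp'⟩ := hG.connected.exists_walk_length_eq_dist u w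
  have hpath : (SimpleGraph.Walk.cons huv.symm p').IsPath := by
    refine SimpleGraph.Walk.isPath_of_length_eq_dist _ ?_
    rw [SimpleGraph.Walk.length_cons, hp', G.dist_comm, ← hd, G.dist_comm]
  rw [(hG.existsUnique_path v w).unique hp hpath]
  simp

/-- Both the given neighbour and the chosen parent are the second vertex of the unique path from `v`
to the root. -/
theorem parent_eq (hG : G.IsTree) {w u v : V} (huv : G.Adj u v)
    (hd : G.dist w v = G.dist w u + 1) : parent G w v = u := by
  have hv : v ≠ w := by rintro rfl; simp at hd
  obtain ⟨p, hp, -⟩ := hG.existsUnique_path v w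
  rw [← snd_eq_of_isPath hG huv hd hp,
    ← snd_eq_of_isPath hG (adj_parent hG hv) (dist_parent hG hv) hp]

theorem adj_and_dist_iff (hG : G.IsTree) {w x y : V} :
    (G.Adj x y ∧ G.dist w y = G.dist w x + 1) ↔ y ≠ w ∧ parent G w y = x := by
  constructor
  · rintro ⟨h1, h2⟩
    exact ⟨by rintro rfl; simp at h2, parent_eq hG h1 h2⟩
  · rintro ⟨h1, rfl⟩
    exact ⟨adj_parent hG h1, dist_parent hG h1⟩

/-- Adjacent vertices of a tree have distances from the root differing by one, so one endpoint of
each edge is the parent of the other. -/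
theorem adj_iff_parent (hG : G.IsTree) (w : V) {x y : V} :
    G.Adj x y ↔ (y ≠ w ∧ parent G w y = x) ∨ (x ≠ w ∧ parent G w x = y) := by
  rw [← adj_and_dist_iff hG, ← adj_and_dist_iff hG]
  constructor
  · intro h
    rcases hG.dist_eq_dist_add_one_of_adj w h with h' | h'
    · exact Or.inr ⟨h.symm, h'⟩
    · exact Or.inl ⟨h, h'⟩
  · rintro (h | h)
    exacts [h.1, h.1.symm]

/-- A finite set of vertices is rooted at `w` if it contains `w` and the parents of its elements. -/
def IsRooted (G : SimpleGraph V) (w : V) (Λ : Finset V) : Prop :=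
  w ∈ Λ ∧ ∀ v ∈ Λ, parent G w v ∈ Λ

/-- A path to the root inside `Λ` is also the path in `G`, and its second vertex is the parent. -/
theorem isRooted_of_connected (hG : G.IsTree) {Λ : Finset V}
    (hΛ : (G.induce (Λ : Set V)).Connected) {w : V} (hw : w ∈ Λ) : IsRooted G w Λ := by
  refine ⟨hw, fun v hv => ?_⟩
  by_cases hvw : v = w
  · rw [hvw, parent_root]; exact hw
  obtain ⟨p, hp⟩ := (hΛ.exists_path_of_dist ⟨v, hv⟩ ⟨w, hw⟩)
  let φ := (SimpleGraph.Embedding.induce (G := G) (Λ : Set V))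
  have hp' : (p.map φ.toHom).IsPath := hp.1.map φ.injective
  have h := snd_eq_of_isPath hG (adj_parent hG hvw) (dist_parent hG hvw) hp'
  have hmem := (p.map φ.toHom).getVert_mem_support 1
  rw [SimpleGraph.Walk.support_map, List.mem_map] at hmem
  obtain ⟨u, -, hu⟩ := hmem
  have : parent G w v = u := by rw [← h]; exact hu.symm
  rw [this]
  exact u.2

theorem exists_connected_superset (hG : G.IsTree) (S : Finset V) :
    ∃ Λ : Finset V, S ⊆ Λ ∧ (G.induce (Λ : Set V)).Connected := by
  classical
  obtain ⟨v⟩ := hG.connected.nonempty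
  obtain ⟨Λ, h1, h2⟩ := SimpleGraph.extend_finset_to_connected hG.connected.preconnected
    (Finset.insert_nonempty v S)
  exact ⟨Λ, (Finset.subset_insert v S).trans h1, h2⟩

/-- Recursion along the rooted tree. -/
def treeRecAux {β : Type*} (G : SimpleGraph V) (w : V) (init : β) (step : V → β → β) :
    ℕ → V → β
  | 0, _ => init
  | n + 1, v => step v (treeRecAux G w init step n (parent G w v))

/-- The function on the rooted tree with value `init` at the root and `step v b` at `v`, where `b`
is the value at the parent of `v`. -/
def treeRec {β : Type*} (G : SimpleGraph V) (w : V) (init : β) (step : V → β → β) (v : V) : β :=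
  treeRecAux G w init step (G.dist w v) v

theorem treeRec_root {β : Type*} (w : V) (init : β) (step : V → β → β) :
    treeRec G w init step w = init := by
  simp [treeRec, treeRecAux]

theorem treeRec_of_ne {β : Type*} (hG : G.IsTree) {w v : V} (hv : v ≠ w) (init : β)
    (step : V → β → β) :
    treeRec G w init step v = step v (treeRec G w init step (parent G w v)) := by
  rw [treeRec, dist_parent hG hv]
  rfl

/-- Induction along the rooted tree. -/
theorem tree_induction (hG : G.IsTree) (w : V) {P : V → Prop} (hw : P w)
    (hstep : ∀ v, v ≠ w → P (parent G w v) → P v) (v : V) : P v := by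
  induction hn : G.dist w v generalizing v with
  | zero =>
    rwa [← (hG.connected.dist_eq_zero_iff.1 hn)]
  | succ n ih =>
    have hv : v ≠ w := by rintro rfl; simp at hn
    exact hstep v hv (ih _ (by have := dist_parent hG hv; omega))

open Classical in
/-- The vertices of `Λ` other than the root whose parent is in `Λ`. -/
def inner (G : SimpleGraph V) (w : V) (Λ : Finset V) : Finset V :=
  Λ.filter fun v => v ≠ w ∧ parent G w v ∈ Λ

open Classical in
theorem inner_of_isRooted {w : V} {Λ : Finset V} (h : IsRooted G w Λ) :
    inner G w Λ = Λ.erase w := by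
  ext v
  simp only [inner, Finset.mem_filter, Finset.mem_erase]
  exact ⟨fun hv => ⟨hv.2.1, hv.1⟩, fun hv => ⟨hv.2, hv.1, h.2 v hv.2⟩⟩

/-- For each `y` at most one `x` contributes a factor, namely the parent of `y`; the double product
thus collapses to one factor per non-root vertex whose parent is present. -/
theorem treeProd_eq_prod_inner (hG : G.IsTree) (Λ : Finset V) (w : V) (f : V → V → ℝ) :
    treeProd G Λ w (fun x y => f x y) = ∏ v ∈ inner G w Λ, f (parent G w v) v := by
  classical
  rw [treeProd, Finset.prod_comm, inner, Finset.prod_filter,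
    ← Finset.prod_coe_sort Λ]
  refine Finset.prod_congr rfl fun y _ => ?_
  simp only [adj_and_dist_iff hG]
  split_ifs with hy
  · rw [Finset.prod_eq_single ⟨parent G w y, hy.2⟩]
    · simp [hy.1]
    · intro x _ hx
      rw [if_neg]
      rintro ⟨-, h⟩
      exact hx (Subtype.ext h.symm)
    · simp
  · refine Finset.prod_eq_one fun x _ => ?_
    rw [if_neg]
    rintro ⟨h1, h2⟩
    exact hy ⟨h1, h2 ▸ x.2⟩

open Classical in
/-- The edges with both endpoints in `Λ`. -/
def edgesIn (G : SimpleGraph V) (Λ : Finset V) : Finset (Sym2 V) :=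
  Λ.sym2.filter fun e => e ∈ G.edgeSet

theorem mem_edgesIn {Λ : Finset V} {x y : V} :
    s(x, y) ∈ edgesIn G Λ ↔ G.Adj x y ∧ x ∈ Λ ∧ y ∈ Λ := by
  simp only [edgesIn, Finset.mem_filter, Finset.mk_mem_sym2_iff, SimpleGraph.mem_edgeSet]
  tauto

/-- If one edge were the parent edge of both its endpoints, each endpoint would be farther from the
root than the other. -/
theorem injOn_parentEdge (hG : G.IsTree) (w : V) (Λ : Finset V) :
    Set.InjOn (fun v => s(parent G w v, v)) (inner G w Λ : Set V) := by
  classical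
  intro u hu v hv huv
  simp only [inner, Finset.coe_filter, Set.mem_ofPred_eq] at hu hv
  simp only [Sym2.eq_iff] at huv
  rcases huv with h | h
  · exact h.2
  · have h1 := dist_parent hG hu.2.1
    have h2 := dist_parent hG hv.2.1
    rw [h.1] at h1
    rw [← h.2] at h2
    omega

open Classical in
theorem edgesIn_eq_image (hG : G.IsTree) (w : V) (Λ : Finset V) :
    edgesIn G Λ = (inner G w Λ).image fun v => s(parent G w v, v) := by
  ext e
  induction e using Sym2.ind with
  | _ x y =>
    rw [mem_edgesIn, Finset.mem_image, adj_iff_parent hG w]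
    simp only [inner, Finset.mem_filter]
    constructor
    · rintro ⟨⟨h1, rfl⟩ | ⟨h1, rfl⟩, hx, hy⟩
      · exact ⟨y, ⟨hy, h1, hx⟩, rfl⟩
      · exact ⟨x, ⟨hx, h1, hy⟩, Sym2.eq_swap⟩
    · rintro ⟨v, ⟨hv, hvw, hp⟩, h⟩
      rcases Sym2.eq_iff.1 h with ⟨rfl, rfl⟩ | ⟨rfl, rfl⟩
      · exact ⟨Or.inl ⟨hvw, rfl⟩, hp, hv⟩
      · exact ⟨Or.inr ⟨hvw, rfl⟩, hv, hp⟩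

theorem prod_inner_eq_prod_edgesIn (hG : G.IsTree) (w : V) (Λ : Finset V) (F : Sym2 V → ℝ) :
    ∏ v ∈ inner G w Λ, F s(parent G w v, v) = ∏ e ∈ edgesIn G Λ, F e := by
  classical
  rw [edgesIn_eq_image hG w, Finset.prod_image (injOn_parentEdge hG w Λ)]

/-- The product of a symmetric function over the edges does not depend on the root. -/
theorem prod_inner_root_independent (hG : G.IsTree) (w w' : V) (Λ : Finset V) {f : V → V → ℝ}
    (hf : ∀ x y, f x y = f y x) :
    ∏ v ∈ inner G w Λ, f (parent G w v) v = ∏ v ∈ inner G w' Λ, f (parent G w' v) v := by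
  have h := fun w => prod_inner_eq_prod_edgesIn hG w Λ (Sym2.lift ⟨f, hf⟩)
  simp only [Sym2.lift_mk] at h
  rw [h, h]

open Classical in
-- The children of `x` are its neighbours other than its parent. At the root the convention `parent
-- G w w = w` makes the erasure vacuous, since `w` is not its own neighbour.
theorem filter_parent_eq (hG : G.IsTree) [G.LocallyFinite] {w x : V} {Λ : Finset V}
    (hnb : ∀ y, G.Adj x y → y ∈ Λ) :
    (Λ.erase w).filter (fun v => parent G w v = x)
      = (G.neighborFinset x).erase (parent G w x) := by
  ext v
  simp only [Finset.mem_filter, Finset.mem_erase, SimpleGraph.mem_neighborFinset]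
  constructor
  · rintro ⟨⟨hvw, -⟩, rfl⟩
    refine ⟨fun h => ?_, adj_parent hG hvw⟩
    by_cases hpw : parent G w v = w
    · rw [hpw, parent_root] at h; exact hvw h
    · have h1 := dist_parent hG hvw
      have h2 := dist_parent hG hpw
      rw [← h] at h2
      omega
  · rintro ⟨h1, h2⟩
    rcases (adj_iff_parent hG w).1 h2 with h | h
    · exact ⟨⟨h.1, hnb v h2⟩, h.2⟩
    · exact absurd h.2.symm h1

open Classical in
-- The count `d` away from the root is the exponent in the boundary law equation, which is what
-- makes the cancellation in `boundaryWeight_congr` work.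
theorem card_children (hG : G.IsTree) [G.LocallyFinite] {d : ℕ}
    (hreg : G.IsRegularOfDegree (d + 1)) {w x : V} {Λ : Finset V}
    (hnb : ∀ y, G.Adj x y → y ∈ Λ) :
    ((Λ.erase w).filter (fun v => parent G w v = x)).card = if x = w then d + 1 else d := by
  rw [filter_parent_eq hG hnb]
  have hdeg : (G.neighborFinset x).card = d + 1 := hreg x
  split_ifs with h
  · rw [h, parent_root, Finset.erase_eq_of_notMem (by simp), ← h, hdeg]
  · rw [Finset.card_erase_of_mem, hdeg, Nat.add_sub_cancel]
    rw [SimpleGraph.mem_neighborFinset]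
    exact (adj_parent hG h).symm

/-- A finite tree has one edge fewer than vertices, while the degree sum would require `(d + 1) *
|V|` to be twice the number of edges. Infinitude provides a root outside any finite volume. -/
theorem infinite_of_regular (hG : G.IsTree) [G.LocallyFinite] {d : ℕ} (hd : 1 ≤ d)
    (hreg : G.IsRegularOfDegree (d + 1)) : Infinite V := by
  classical
  by_contra h
  rw [not_infinite_iff_finite] at h
  have := Fintype.ofFinite V
  have h1 := hG.card_edgeFinset
  have h2 := G.sum_degrees_eq_twice_card_edges
  have h3 : ∑ _v : V, (d + 1) = 2 * G.edgeFinset.card := by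
    rw [← h2]
    exact Finset.sum_congr rfl fun v _ => by rw [← hreg v]; convert rfl
  simp only [Finset.sum_const, Finset.card_univ, smul_eq_mul] at h3
  nlinarith

end TreeCombinatorics

/-! ### Discrete laws and measures on countable products -/

section DiscreteLaw

variable {β : Type*} [MeasurableSpace β]

/-- The measure on a countable space with weights `p`. -/
def law (p : β → ℝ) : Measure β :=
  Measure.sum fun j => ENNReal.ofReal (p j) • Measure.dirac j

theorem law_singleton [MeasurableSingletonClass β] (p : β → ℝ) (j : β) : law p {j} = ENNReal.ofReal (p j) := by
  rw [law, Measure.sum_apply _ (measurableSet_singleton j), tsum_eq_single j]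
  · simp
  · intro i hi
    simp [hi]

theorem isProbabilityMeasure_law {p : β → ℝ} (hp : ∀ j, 0 ≤ p j) (h1 : HasSum p 1) :
    IsProbabilityMeasure (law p) := by
  constructor
  rw [law, Measure.sum_apply _ MeasurableSet.univ]
  simp only [Measure.smul_apply, measure_univ, smul_eq_mul, mul_one]
  rw [← ENNReal.ofReal_tsum_of_nonneg hp h1.summable, h1.tsum_eq, ENNReal.ofReal_one]

variable [MeasurableSingletonClass β] [Countable β]

/-- Measures on a product of countable spaces are determined by the probabilities of the events
prescribing finitely many coordinates. -/
theorem ext_of_cylinders {ι : Type*} [Nonempty β] {μ ν : Measure (ι → β)}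
    [IsFiniteMeasure μ] {F : Finset ι → Prop} (hF : ∀ I, ∃ J, I ⊆ J ∧ F J)
    (h : ∀ J, F J → ∀ t : ι → β, μ {η | ∀ i ∈ J, η i = t i} = ν {η | ∀ i ∈ J, η i = t i}) :
    μ = ν := by
  classical
  have hJ : ∀ J, F J → μ.map J.restrict = ν.map J.restrict := by
    intro J hFJ
    refine Measure.ext_of_singleton fun t => ?_
    let t' : ι → β := fun i => if hi : i ∈ J then t ⟨i, hi⟩ else Classical.arbitrary β
    have hset : (J.restrict : (ι → β) → J → β) ⁻¹' {t} = {η : ι → β | ∀ i ∈ J, η i = t' i} := by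
      ext η
      simp only [Set.mem_preimage, Set.mem_singleton_iff, Set.mem_ofPred_eq]
      constructor
      · rintro rfl i hi
        simp [t', hi]
      · intro hη
        ext ⟨i, hi⟩
        simpa [t', hi] using hη i hi
    rw [Measure.map_apply (Finset.measurable_restrict J) (measurableSet_singleton t),
      Measure.map_apply (Finset.measurable_restrict J) (measurableSet_singleton t), hset, h J hFJ]
  -- A finite measure on the product is determined by its finite-dimensional marginals, and the
  -- marginal on `I` is read off from that on a larger `J` satisfying `F`.
  refine IsProjectiveLimit.unique (P := fun I => μ.map I.restrict) (fun I => rfl) fun I => ?_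
  obtain ⟨J, hIJ, hFJ⟩ := hF I
  have hcomp : (I.restrict : (ι → β) → _) = Finset.restrict₂ (π := fun _ => β) hIJ ∘ J.restrict := rfl
  beta_reduce
  rw [hcomp, ← Measure.map_map (Finset.measurable_restrict₂ hIJ) (Finset.measurable_restrict J),
    ← Measure.map_map (Finset.measurable_restrict₂ hIJ) (Finset.measurable_restrict J), hJ J hFJ]

end DiscreteLaw

/-! ### The tree-indexed Markov chain -/

section Chain

variable {V : Type*} {G : SimpleGraph V}

theorem measurable_treeRec {Ω β : Type*} [MeasurableSpace Ω] [MeasurableSpace β] (w : V)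
    {init : Ω → β} (hinit : Measurable init) {step : Ω → V → β → β}
    (hstep : ∀ v, ∀ f : Ω → β, Measurable f → Measurable fun ω => step ω v (f ω)) (v : V) :
    Measurable fun ω => treeRec G w (init ω) (step ω) v := by
  have : ∀ n v, Measurable fun ω => treeRecAux G w (init ω) (step ω) n v := by
    intro n
    induction n with
    | zero => exact fun v => hinit
    | succ n ih => exact fun v => hstep v _ (ih _)
  exact this _ v

/-- Evaluating a random function at a random point of a countable space is measurable. -/
theorem measurable_eval_countable {Ω ι β : Type*} [MeasurableSpace Ω] [MeasurableSpace β]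
    {S : Type*} [MeasurableSpace S] [MeasurableSingletonClass S] [Countable S]
    {ξ : Ω → ι → β} (hξ : Measurable ξ) (c : S → ι) {f : Ω → S} (hf : Measurable f) :
    Measurable fun ω => ξ ω (c (f ω)) := by
  have : Measurable fun p : S × Ω => ξ p.2 (c p.1) :=
    measurable_from_prod_countable_right fun s => (measurable_pi_apply (c s)).comp hξ
  exact this.comp (hf.prodMk measurable_id)

variable {S : Type*} [MeasurableSpace S] [MeasurableSingletonClass S] [Countable S]

/-- The law on `V → S` of the tree-indexed Markov chain with initial weights `a` at the root `w` and
transition weights `p`. -/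
def chainLaw (G : SimpleGraph V) (w : V) (a : S → ℝ) (p : S → S → ℝ) : Measure (V → S) :=
  ((law a).prod (Measure.infinitePi fun i : V × S => law (p i.2))).map
    fun ω v => treeRec G w ω.1 (fun v s => ω.2 (v, s)) v

theorem measurable_chain (w : V) :
    Measurable fun (ω : S × (V × S → S)) v => treeRec G w ω.1 (fun v s => ω.2 (v, s)) v :=
  measurable_pi_lambda _ fun v => measurable_treeRec w measurable_fst
    (fun v _ hf => measurable_eval_countable measurable_snd (fun s => (v, s)) hf) v

theorem isProbabilityMeasure_chainLaw (w : V) {a : S → ℝ} {p : S → S → ℝ} (ha : ∀ s, 0 ≤ a s)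
    (ha1 : HasSum a 1) (hp : ∀ s t, 0 ≤ p s t) (hp1 : ∀ s, HasSum (p s) 1) :
    IsProbabilityMeasure (chainLaw G w a p) := by
  have := isProbabilityMeasure_law ha ha1
  have : ∀ i : V × S, IsProbabilityMeasure (law (p i.2)) := fun i =>
    isProbabilityMeasure_law (hp i.2) (hp1 i.2)
  exact Measure.isProbabilityMeasure_map (measurable_chain w).aemeasurable

theorem measurableSet_cylinder {ι β : Type*} [MeasurableSpace β] [MeasurableSingletonClass β]
    (J : Finset ι) (t : ι → β) : MeasurableSet {η : ι → β | ∀ i ∈ J, η i = t i} := by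
  have : {η : ι → β | ∀ i ∈ J, η i = t i} = (J : Set ι).pi fun i => {t i} := by ext; simp [Set.mem_pi]
  rw [this]
  exact MeasurableSet.pi J.countable_toSet fun i _ => measurableSet_singleton _

/-- The chain is driven by independent variables indexed by pairs (vertex, state of its parent). On
a rooted set the event fixes the initial state and, for each other `v`, the variable at `(v, t
(parent v))`. These indices are distinct, so the probability is a product. -/
theorem chainLaw_cylinder (hG : G.IsTree) {w : V} {a : S → ℝ} {p : S → S → ℝ}
    (ha : ∀ s, 0 ≤ a s) (hp : ∀ s t, 0 ≤ p s t)
    (hp1 : ∀ s, HasSum (p s) 1) {Λ : Finset V} (hΛ : IsRooted G w Λ) (t : V → S) :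
    chainLaw G w a p {σ | ∀ x ∈ Λ, σ x = t x}
      = ENNReal.ofReal (a (t w) * ∏ v ∈ inner G w Λ, p (t (parent G w v)) (t v)) := by
  classical
  have : ∀ i : V × S, IsProbabilityMeasure (law (p i.2)) := fun i =>
    isProbabilityMeasure_law (hp i.2) (hp1 i.2)
  rw [chainLaw, Measure.map_apply (measurable_chain w) (measurableSet_cylinder Λ t)]
  set J : Finset (V × S) := (inner G w Λ).image fun v => (v, t (parent G w v)) with hJ
  have hset : (fun (ω : S × (V × S → S)) v => treeRec G w ω.1 (fun v s => ω.2 (v, s)) v) ⁻¹'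
      {σ | ∀ x ∈ Λ, σ x = t x} = {t w} ×ˢ (J : Set (V × S)).pi fun i => {t i.1} := by
    ext ω
    simp only [Set.mem_preimage, Set.mem_ofPred_eq, Set.mem_prod, Set.mem_singleton_iff, Set.mem_pi,
      hJ, Finset.coe_image, Set.forall_mem_image, Finset.mem_coe, inner_of_isRooted hΛ,
      Finset.mem_erase]
    constructor
    · intro h
      refine ⟨?_, fun v hv => ?_⟩
      · rw [← h w hΛ.1, treeRec_root]
      · rw [← h v hv.2, treeRec_of_ne hG hv.1, h _ (hΛ.2 v hv.2)]
    · rintro ⟨h1, h2⟩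
      refine tree_induction hG w (fun _ => by rw [treeRec_root, h1]) fun v hv ih hvΛ => ?_
      rw [treeRec_of_ne hG hv, ih (hΛ.2 v hvΛ), h2 ⟨hv, hvΛ⟩]
  rw [hset, Measure.prod_prod, Measure.infinitePi_pi _ fun i _ => measurableSet_singleton _,
    law_singleton, hJ, Finset.prod_image fun u _ v _ h => (Prod.ext_iff.1 h).1,
    ENNReal.ofReal_mul (ha _), ENNReal.ofReal_prod_of_nonneg fun v _ => hp _ _]
  simp only [law_singleton]

/-- For reversible weights the law of the chain does not depend on the root. -/
theorem chainLaw_root_independent [Nonempty S] (hG : G.IsTree) (w w' : V) {a : S → ℝ}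
    {p : S → S → ℝ} (ha : ∀ s, 0 < a s) (ha1 : HasSum a 1) (hp : ∀ s t, 0 ≤ p s t)
    (hp1 : ∀ s, HasSum (p s) 1) (hrev : ∀ s t, a s * p s t = a t * p t s) :
    chainLaw G w a p = chainLaw G w' a p := by
  classical
  have := isProbabilityMeasure_chainLaw (G := G) w (fun s => (ha s).le) ha1 hp hp1
  refine ext_of_cylinders (F := fun Λ => (G.induce (Λ : Set V)).Connected ∧ w ∈ Λ ∧ w' ∈ Λ)
    (fun I => ?_) fun Λ hΛ t => ?_
  · obtain ⟨Λ, h1, h2⟩ := exists_connected_superset hG (insert w (insert w' I))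
    exact ⟨Λ, fun v hv => h1 (by simp [hv]), h2, h1 (by simp), h1 (by simp)⟩
  · have key : ∀ u ∈ Λ, a (t u) * ∏ v ∈ inner G u Λ, p (t (parent G u v)) (t v)
        = (∏ v ∈ Λ, a (t v)) *
          ∏ v ∈ inner G u Λ, p (t (parent G u v)) (t v) / a (t v) := by
      intro u hu
      have hr := isRooted_of_connected hG hΛ.1 hu
      have hne : ∏ v ∈ inner G u Λ, a (t v) ≠ 0 := Finset.prod_ne_zero_iff.2 fun v _ => (ha _).ne'
      rw [Finset.prod_div_distrib, ← Finset.mul_prod_erase Λ _ hu, ← inner_of_isRooted hr]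
      field_simp
    rw [chainLaw_cylinder hG (fun s => (ha s).le) hp hp1 (isRooted_of_connected hG hΛ.1 hΛ.2.1),
      chainLaw_cylinder hG (fun s => (ha s).le) hp hp1 (isRooted_of_connected hG hΛ.1 hΛ.2.2),
      key w hΛ.2.1, key w' hΛ.2.2,
      prod_inner_root_independent hG w w' Λ (f := fun x y => p (t x) (t y) / a (t y))]
    intro x y
    rw [div_eq_div_iff (ha _).ne' (ha _).ne', mul_comm, hrev, mul_comm]

end Chain

/-! ### Integer increments given the fuzzy chain -/

section Increments

variable {V : Type*} {G : SimpleGraph V} {S : Type*} [AddGroup S] [MeasurableSpace S]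
  [MeasurableSingletonClass S] [Countable S]

/-- The heights obtained by adding up increments `ξ (v, σ v - σ (parent v))`. -/
def heights (G : SimpleGraph V) (w : V) (ω : (V → S) × (V × S → ℤ)) (v : V) : ℤ :=
  treeRec G w (0 : ℤ) (fun v h => h + ω.2 (v, ω.1 v - ω.1 (parent G w v))) v

/-- The gradient measure: given `σ` with law `P`, the increment along the edge from the parent of
`v` to `v` has the weights `r (σ v - σ (parent v))`, independently over `v`. -/
def incrementMeasure (G : SimpleGraph V) (w : V) (P : Measure (V → S)) (r : S → ℤ → ℝ) :
    Measure (G.Dart → ℤ) :=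
  (P.prod (Measure.infinitePi fun i : V × S => law (r i.2))).map fun ω => grad G (heights G w ω)

theorem measurable_grad : Measurable (grad G) :=
  measurable_pi_lambda _ fun _ => (measurable_pi_apply _).sub (measurable_pi_apply _)

theorem measurable_heights (w : V) : Measurable (heights (S := S) G w) := by
  refine measurable_pi_lambda _ fun v => measurable_treeRec w measurable_const
    (fun v f hf => hf.add ?_) v
  have hf : Measurable fun ω : (V → S) × (V × S → ℤ) => (ω.1 v, ω.1 (parent G w v)) :=
    ((measurable_pi_apply v).comp measurable_fst).prodMk
      ((measurable_pi_apply (parent G w v)).comp measurable_fst)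
  exact measurable_eval_countable (S := S × S) measurable_snd (fun s => (v, s.1 - s.2)) hf

/-- The gradient cylinder: the increments agree with those of `ω` inside `Λ`. -/
def gradCylinder (G : SimpleGraph V) (Λ : Finset V) (ω : V → ℤ) : Set (G.Dart → ℤ) :=
  {η | ∀ e : G.Dart, e.fst ∈ Λ → e.snd ∈ Λ → η e = grad G ω e}

/-- Each edge inside `Λ` is a parent edge, and an increment along the reversed dart is only a change
of sign. -/
theorem grad_mem_gradCylinder_iff (hG : G.IsTree) (w : V) {Λ : Finset V} {ω ω' : V → ℤ} :
    grad G ω' ∈ gradCylinder G Λ ω ↔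
      ∀ v ∈ inner G w Λ, ω' v - ω' (parent G w v) = ω v - ω (parent G w v) := by
  classical
  simp only [gradCylinder, Set.mem_ofPred_eq, grad, inner, Finset.mem_filter]
  constructor
  · rintro h v ⟨hv, hvw, hp⟩
    exact h ⟨(parent G w v, v), adj_parent hG hvw⟩ hp hv
  · rintro h ⟨⟨x, y⟩, hxy⟩ hx hy
    simp only at hx hy ⊢
    rcases (adj_iff_parent hG w).1 hxy with ⟨h1, h2⟩ | ⟨h1, h2⟩ <;> simp only at h1 h2
    · subst h2
      exact h y ⟨hy, h1, hx⟩
    · subst h2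
      have := h x ⟨hx, h1, hy⟩
      omega

theorem finite_darts (Λ : Finset V) : {e : G.Dart | e.fst ∈ Λ ∧ e.snd ∈ Λ}.Finite := by
  refine Set.Finite.of_finite_image (f := SimpleGraph.Dart.toProd)
    ((Λ ×ˢ Λ).finite_toSet.subset ?_) SimpleGraph.Dart.toProd_injective.injOn
  rintro _ ⟨e, he, rfl⟩
  simpa using he

theorem gradCylinder_eq (Λ : Finset V) (ω : V → ℤ) :
    gradCylinder G Λ ω = {η | ∀ e ∈ (finite_darts (G := G) Λ).toFinset, η e = grad G ω e} := by
  ext η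
  simp [gradCylinder]

theorem measurableSet_gradCylinder (Λ : Finset V) (ω : V → ℤ) :
    MeasurableSet (gradCylinder G Λ ω) := by
  rw [gradCylinder_eq]
  exact measurableSet_cylinder _ _

/-- Given `σ`, the increments along different parent edges read different coordinates of a product
measure. Only increments are prescribed, not heights, so `Λ` need not be rooted or connected. -/
theorem incrementMeasure_gradCylinder (hG : G.IsTree) (w : V) {P : Measure (V → S)}
    [IsProbabilityMeasure P] {r : S → ℤ → ℝ} (hr : ∀ s j, 0 ≤ r s j)
    (hr1 : ∀ s, HasSum (r s) 1) (Λ : Finset V) (ω : V → ℤ) :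
    incrementMeasure G w P r (gradCylinder G Λ ω) = ∫⁻ σ, ENNReal.ofReal
      (∏ v ∈ inner G w Λ, r (σ v - σ (parent G w v)) (ω v - ω (parent G w v))) ∂P := by
  classical
  have : ∀ i : V × S, IsProbabilityMeasure (law (r i.2)) := fun i =>
    isProbabilityMeasure_law (hr i.2) (hr1 i.2)
  have hmeas : Measurable fun ω : (V → S) × (V × S → ℤ) => grad G (heights G w ω) :=
    measurable_grad.comp (measurable_heights w)
  rw [incrementMeasure, Measure.map_apply hmeas (measurableSet_gradCylinder Λ ω),
    Measure.prod_apply (hmeas (measurableSet_gradCylinder Λ ω))]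
  refine lintegral_congr fun σ => ?_
  set J : Finset (V × S) := (inner G w Λ).image fun v => (v, σ v - σ (parent G w v)) with hJ
  have hset : Prod.mk σ ⁻¹' ((fun ω : (V → S) × (V × S → ℤ) => grad G (heights G w ω)) ⁻¹'
      gradCylinder G Λ ω) = (J : Set (V × S)).pi fun i => {ω i.1 - ω (parent G w i.1)} := by
    ext ξ
    simp only [Set.mem_preimage, grad_mem_gradCylinder_iff hG w, Set.mem_pi, hJ, Finset.coe_image,
      Set.forall_mem_image, Finset.mem_coe, Set.mem_singleton_iff]
    refine forall₂_congr fun v hv => ?_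
    have hvw : v ≠ w := by
      simp only [inner, Finset.mem_filter] at hv
      exact hv.2.1
    rw [heights, treeRec_of_ne hG hvw, heights, add_sub_cancel_left]
  rw [hset, Measure.infinitePi_pi _ fun i _ => measurableSet_singleton _, hJ,
    Finset.prod_image fun u _ v _ h => (Prod.ext_iff.1 h).1,
    ENNReal.ofReal_prod_of_nonneg fun v _ => hr _ _]
  simp only [law_singleton]

end Increments

/-! ### Gradient configurations and their cylinders -/

section Gradients

variable {V : Type*} {G : SimpleGraph V}

open Classical in
/-- The height configuration with gradient `ζ` which vanishes at `o`. -/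
def pinnedHeights (G : SimpleGraph V) (o : V) (ζ : G.Dart → ℤ) (v : V) : ℤ :=
  treeRec G o (0 : ℤ)
    (fun v h => h + if hv : G.Adj (parent G o v) v then ζ ⟨(parent G o v, v), hv⟩ else 0) v

theorem measurable_pinnedHeights (o : V) : Measurable (pinnedHeights G o) := by
  classical
  refine measurable_pi_lambda _ fun v => measurable_treeRec o measurable_const
    (fun v f hf => hf.add ?_) v
  split_ifs
  exacts [measurable_pi_apply _, measurable_const]

theorem pinnedHeights_grad (hG : G.IsTree) (o : V) (ω : V → ℤ) (v : V) :
    pinnedHeights G o (grad G ω) v = ω v - ω o := by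
  refine tree_induction hG o (P := fun v => pinnedHeights G o (grad G ω) v = ω v - ω o) ?_
    (fun v hv ih => ?_) v
  · rw [pinnedHeights, treeRec_root, sub_self]
  · rw [pinnedHeights] at ih ⊢
    rw [treeRec_of_ne hG hv, ih, dif_pos (adj_parent hG hv)]
    simp [grad]

theorem grad_sub_const (ω : V → ℤ) (k : ℤ) : grad G (fun v => ω v - k) = grad G ω := by
  ext e
  simp [grad]

theorem grad_pinnedHeights (hG : G.IsTree) (o : V) {ζ : G.Dart → ℤ}
    (hζ : ∃ ω : V → ℤ, grad G ω = ζ) : grad G (pinnedHeights G o ζ) = ζ := by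
  obtain ⟨ω, rfl⟩ := hζ
  rw [funext (pinnedHeights_grad hG o ω), grad_sub_const]

/-- Balls around a vertex are finite, by induction on the radius. Countability is needed to make the
set of gradient configurations measurable. -/
theorem countable_of_locallyFinite (hG : G.Connected) [G.LocallyFinite] : Countable V := by
  classical
  obtain ⟨w⟩ := hG.nonempty
  have hfin : ∀ n : ℕ, {v | G.dist w v ≤ n}.Finite := by
    intro n
    induction n with
    | zero =>
      refine (Set.finite_singleton w).subset fun v hv => ?_
      simpa [hG.dist_eq_zero_iff, eq_comm] using hv
    | succ n ih =>
      refine (ih.union (ih.biUnion fun u _ => (G.neighborFinset u).finite_toSet)).subset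
        fun v hv => ?_
      rcases Nat.le_succ_iff.1 hv with h | h
      · exact Or.inl h
      · refine Or.inr ?_
        obtain ⟨p, hp⟩ := hG.exists_walk_length_eq_dist v w
        cases p with
        | nil => simp at h
        | @cons _ u _ huv p =>
          rw [SimpleGraph.Walk.length_cons, G.dist_comm, h] at hp
          have h1 := G.dist_le p
          rw [G.dist_comm] at h1
          simp only [Set.mem_iUnion, Finset.mem_coe, SimpleGraph.mem_neighborFinset]
          exact ⟨u, show G.dist w u ≤ n by omega, huv.symm⟩
  have : (Set.univ : Set V) = ⋃ n : ℕ, {v | G.dist w v ≤ n} := by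
    ext v
    simp only [Set.mem_univ, Set.mem_iUnion, true_iff]
    exact ⟨G.dist w v, le_refl (G.dist w v)⟩
  rw [← Set.countable_univ_iff, this]
  exact Set.countable_iUnion fun n => (hfin n).countable

/-- A configuration is a gradient precisely when it is the gradient of its own pinned heights, which
is a countable family of measurable conditions, one per dart. -/
theorem measurableSet_gradients (hG : G.IsTree) [G.LocallyFinite] :
    MeasurableSet {ζ : G.Dart → ℤ | ∃ ω : V → ℤ, grad G ω = ζ} := by
  have := countable_of_locallyFinite hG.connected
  have : Countable G.Dart := SimpleGraph.Dart.toProd_injective.countable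
  obtain ⟨o⟩ := hG.connected.nonempty
  have : {ζ : G.Dart → ℤ | ∃ ω : V → ℤ, grad G ω = ζ}
      = ⋂ e, {ζ | grad G (pinnedHeights G o ζ) e = ζ e} := by
    ext ζ
    simp only [Set.mem_ofPred_eq, Set.mem_iInter]
    exact ⟨fun h e => by rw [grad_pinnedHeights hG o h], fun h => ⟨_, funext h⟩⟩
  rw [this]
  refine MeasurableSet.iInter fun e => measurableSet_eq_fun ?_ (measurable_pi_apply e)
  exact (measurable_pi_apply e).comp (measurable_grad.comp (measurable_pinnedHeights o))

theorem incrementMeasure_ae_grad {S : Type*} [AddGroup S] [MeasurableSpace S]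
    [MeasurableSingletonClass S] [Countable S] (hG : G.IsTree) [G.LocallyFinite]
    (w : V) (P : Measure (V → S)) (r : S → ℤ → ℝ) :
    ∀ᵐ ζ ∂(incrementMeasure G w P r), ∃ ω : V → ℤ, grad G ω = ζ := by
  have hmeas : Measurable fun ω : (V → S) × (V × S → ℤ) => grad G (heights G w ω) :=
    measurable_grad.comp (measurable_heights w)
  rw [incrementMeasure, ae_map_iff hmeas.aemeasurable (measurableSet_gradients hG)]
  exact Filter.Eventually.of_forall fun ω => ⟨_, rfl⟩

/-- Two measures carried by gradients agree if they agree on gradient cylinders. -/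
theorem ext_of_gradCylinders {μ ν : Measure (G.Dart → ℤ)} [IsFiniteMeasure μ]
    (hμ : ∀ᵐ ζ ∂μ, ∃ ω : V → ℤ, grad G ω = ζ) (hν : ∀ᵐ ζ ∂ν, ∃ ω : V → ℤ, grad G ω = ζ)
    {F : Finset V → Prop} (hF : ∀ I, ∃ J, I ⊆ J ∧ F J)
    (h : ∀ Λ, F Λ → ∀ ω, μ (gradCylinder G Λ ω) = ν (gradCylinder G Λ ω)) : μ = ν := by
  classical
  refine ext_of_cylinders
    (F := fun J => ∃ Λ, F Λ ∧ J = (finite_darts (G := G) Λ).toFinset) (fun I => ?_) ?_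
  · obtain ⟨Λ, h1, h2⟩ := hF (I.image (fun e => e.fst) ∪ I.image fun e => e.snd)
    refine ⟨_, fun e he => ?_, Λ, h2, rfl⟩
    simp only [Set.Finite.mem_toFinset, Set.mem_ofPred_eq]
    exact ⟨h1 (Finset.mem_union_left _ (Finset.mem_image_of_mem _ he)),
      h1 (Finset.mem_union_right _ (Finset.mem_image_of_mem _ he))⟩
  · rintro _ ⟨Λ, hΛ, rfl⟩ t
    by_cases ht : ∃ ω : V → ℤ, ∀ e ∈ (finite_darts (G := G) Λ).toFinset, t e = grad G ω e
    · obtain ⟨ω, hω⟩ := ht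
      have : {η : G.Dart → ℤ | ∀ e ∈ (finite_darts (G := G) Λ).toFinset, η e = t e}
          = gradCylinder G Λ ω := by
        rw [gradCylinder_eq]
        ext η
        exact forall₂_congr fun e he => by rw [hω e he]
      rw [this, h Λ hΛ]
    -- Increments that no height configuration realizes on `Λ` define an event null for both
    -- measures.
    · have hsub : {η : G.Dart → ℤ | ∀ e ∈ (finite_darts (G := G) Λ).toFinset, η e = t e}
          ⊆ {ζ | ∃ ω : V → ℤ, grad G ω = ζ}ᶜ := by
        rintro η hη ⟨ω, rfl⟩
        exact ht ⟨ω, fun e he => (hη e he).symm⟩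
      rw [measure_mono_null hsub hμ, measure_mono_null hsub hν]

end Gradients

/-! ### Weights of the fuzzy chain and detailed balance -/

section Weights

variable {Q : ℤ → ℝ} {d q : ℕ} {lam : ZMod q → ℝ}

theorem rho_nonneg (hpos : ∀ i, 0 < Q i) (hQ : Summable Q) (s : ZMod q) (j : ℤ) :
    0 ≤ rho Q j s := by
  rw [rho]
  split_ifs
  exacts [div_nonneg (hpos j).le (fuzzyQ_pos hQ hpos s).le, le_rfl]

theorem hasSum_rho (hpos : ∀ i, 0 < Q i) (hQ : Summable Q) (s : ZMod q) :
    HasSum (fun j => rho Q j s) 1 := by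
  have h := (summable_fibre hQ s).hasSum.div_const (fuzzyQ Q s)
  rw [← fuzzyQ, div_self (fuzzyQ_pos hQ hpos s).ne'] at h
  have h2 := (hasSum_subtype_iff_indicator (s := {l : ℤ | (l : ZMod q) = s})
    (f := fun j => Q j / fuzzyQ Q s)).1 h
  refine h2.congr_fun fun j => ?_
  simp [rho, Set.indicator]

theorem rho_neg (heven : ∀ i, Q (-i) = Q i) (j : ℤ) (s : ZMod q) :
    rho Q (-j) (-s) = rho Q j s := by
  simp only [rho, Int.cast_neg, neg_inj, heven, fuzzyQ_neg heven]

variable [NeZero q]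

/-- The normalization `∑_u Q_q(s-u) lam(u)` of the transition matrix. -/
def fuzzyNorm (Q : ℤ → ℝ) (lam : ZMod q → ℝ) (s : ZMod q) : ℝ :=
  ∑ u : ZMod q, fuzzyQ Q (s - u) * lam u

theorem fuzzyNorm_pos (hpos : ∀ i, 0 < Q i) (hQ : Summable Q) (hlam : ∀ s, 0 < lam s)
    (s : ZMod q) : 0 < fuzzyNorm Q lam s :=
  Finset.sum_pos (fun u _ => mul_pos (fuzzyQ_pos hQ hpos _) (hlam u)) Finset.univ_nonempty

theorem IsPeriodicBoundaryLaw.exists_eq_pow (hQ : Summable Q) (h : IsPeriodicBoundaryLaw Q d lam) :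
    ∃ c : ℝ, 0 < c ∧ ∀ s, lam s = c * fuzzyNorm Q lam s ^ d := by
  obtain ⟨c, hc, h⟩ := h.eqn
  refine ⟨c, hc, fun s => ?_⟩
  obtain ⟨i, rfl⟩ := ZMod.intCast_surjective s
  rw [h, tsum_sub_mul_periodic hQ, fuzzyNorm]

theorem fuzzyStationary_pos (hlam : ∀ s, 0 < lam s) (s : ZMod q) : 0 < fuzzyStationary d lam s :=
  div_pos (Real.rpow_pos_of_pos (hlam s) _)
    (Finset.sum_pos (fun t _ => Real.rpow_pos_of_pos (hlam t) _) Finset.univ_nonempty)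

theorem hasSum_fuzzyStationary (hlam : ∀ s, 0 < lam s) : HasSum (fuzzyStationary d lam) 1 := by
  have : ∑ s, fuzzyStationary d lam s = 1 := by
    simp only [fuzzyStationary]
    rw [← Finset.sum_div, div_self]
    exact (Finset.sum_pos (fun t _ => Real.rpow_pos_of_pos (hlam t) _) Finset.univ_nonempty).ne'
  rw [← this]
  exact hasSum_fintype _

/-- Split `lam ^ ((d + 1) / d)` as `lam * lam ^ (1 / d)`. By the boundary law equation the second
factor is a constant times `fuzzyNorm`. -/
theorem exists_fuzzyStationary_eq (hpos : ∀ i, 0 < Q i) (hQ : Summable Q) (hd : 1 ≤ d)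
    (h : IsPeriodicBoundaryLaw Q d lam) :
    ∃ κ : ℝ, 0 < κ ∧ ∀ s, fuzzyStationary d lam s = κ * (lam s * fuzzyNorm Q lam s) := by
  obtain ⟨c, hc, hcd⟩ := h.exists_eq_pow hQ
  have hZ : 0 < ∑ t : ZMod q, lam t ^ (((d : ℝ) + 1) / d) :=
    Finset.sum_pos (fun t _ => Real.rpow_pos_of_pos (h.pos t) _) Finset.univ_nonempty
  refine ⟨c ^ ((d : ℝ)⁻¹) / ∑ t : ZMod q, lam t ^ (((d : ℝ) + 1) / d),
    div_pos (Real.rpow_pos_of_pos hc _) hZ, fun s => ?_⟩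
  have hd0 : (d : ℝ) ≠ 0 := by positivity
  have hN := fuzzyNorm_pos hpos hQ h.pos s
  have : lam s ^ (((d : ℝ) + 1) / d) = c ^ ((d : ℝ)⁻¹) * (lam s * fuzzyNorm Q lam s) := by
    rw [show ((d : ℝ) + 1) / d = 1 + (d : ℝ)⁻¹ by field_simp, Real.rpow_add (h.pos s),
      Real.rpow_one]
    have : lam s ^ ((d : ℝ)⁻¹) = c ^ ((d : ℝ)⁻¹) * fuzzyNorm Q lam s := by
      conv_lhs => rw [hcd s]
      rw [Real.mul_rpow hc.le (by positivity), Real.pow_rpow_inv_natCast hN.le (by omega)]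
    rw [this]; ring
  rw [fuzzyStationary, this]
  ring

theorem fuzzyTransition_nonneg (hpos : ∀ i, 0 < Q i) (hQ : Summable Q) (hlam : ∀ s, 0 < lam s)
    (s t : ZMod q) : 0 ≤ fuzzyTransition Q lam s t :=
  div_nonneg (mul_nonneg (fuzzyQ_pos hQ hpos _).le (hlam t).le) (fuzzyNorm_pos hpos hQ hlam s).le

theorem hasSum_fuzzyTransition (hpos : ∀ i, 0 < Q i) (hQ : Summable Q) (hlam : ∀ s, 0 < lam s)
    (s : ZMod q) : HasSum (fuzzyTransition Q lam s) 1 := by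
  have : ∑ t, fuzzyTransition Q lam s t = 1 := by
    simp only [fuzzyTransition]
    rw [← Finset.sum_div, div_self]
    exact (fuzzyNorm_pos hpos hQ hlam s).ne'
  rw [← this]
  exact hasSum_fintype _

/-- The normalization in the transition matrix cancels the `fuzzyNorm` in the stationary weight.
Both sides become a constant times `lam s * lam t * Q_q(s - t)`, symmetric because `Q` is even. -/
theorem fuzzyTransition_reversible (heven : ∀ i, Q (-i) = Q i) (hpos : ∀ i, 0 < Q i)
    (hQ : Summable Q) (hd : 1 ≤ d) (h : IsPeriodicBoundaryLaw Q d lam) (s t : ZMod q) :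
    fuzzyStationary d lam s * fuzzyTransition Q lam s t
      = fuzzyStationary d lam t * fuzzyTransition Q lam t s := by
  obtain ⟨κ, -, hκ⟩ := exists_fuzzyStationary_eq hpos hQ hd h
  have hs := (fuzzyNorm_pos hpos hQ h.pos s).ne'
  have ht := (fuzzyNorm_pos hpos hQ h.pos t).ne'
  rw [hκ, hκ, fuzzyTransition, fuzzyTransition, ← fuzzyNorm, ← fuzzyNorm, ← neg_sub s t,
    fuzzyQ_neg heven]
  field_simp

end Weights

/-! ### Automorphisms of the tree and the chain -/

section Automorphism

variable {V : Type*} {G : SimpleGraph V}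

theorem dist_iso (hG : G.Connected) (g : G ≃g G) (u v : V) :
    G.dist (g u) (g v) = G.dist u v := by
  have hle : ∀ (g : G ≃g G) (u v : V), G.dist (g u) (g v) ≤ G.dist u v := by
    intro g u v
    obtain ⟨p, hp⟩ := hG.exists_walk_length_eq_dist u v
    rw [← hp, ← p.length_map g.toHom]
    exact G.dist_le (p.map g.toHom)
  refine le_antisymm (hle g u v) ?_
  have := hle g.symm (g u) (g v)
  rwa [RelIso.symm_apply_apply, RelIso.symm_apply_apply] at this

theorem mem_map_iso (g : G ≃g G) (u : V) (A : Finset V) :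
    g u ∈ A.map g.toEquiv.toEmbedding ↔ u ∈ A :=
  Finset.mem_map' g.toEquiv.toEmbedding

/-- Automorphisms preserve adjacency and distance, hence carry the tree rooted at `w` to the tree
rooted at `g w`. -/
theorem parent_iso (hG : G.IsTree) (g : G ≃g G) (w v : V) :
    parent G (g w) (g v) = g (parent G w v) := by
  by_cases hv : v = w
  · rw [hv, parent_root, parent_root]
  · refine parent_eq hG (g.map_adj_iff.2 (adj_parent hG hv)) ?_
    rw [dist_iso hG.connected, dist_iso hG.connected, dist_parent hG hv]

theorem inner_iso (hG : G.IsTree) (g : G ≃g G) (w : V) (Λ : Finset V) :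
    inner G (g w) (Λ.map g.toEquiv.toEmbedding) = (inner G w Λ).map g.toEquiv.toEmbedding := by
  classical
  ext v
  obtain ⟨v, rfl⟩ := g.surjective v
  simp only [inner, mem_map_iso, Finset.mem_filter, parent_iso hG, g.injective.ne_iff]

theorem isRooted_iso (hG : G.IsTree) (g : G ≃g G) {w : V} {Λ : Finset V} (h : IsRooted G w Λ) :
    IsRooted G (g w) (Λ.map g.toEquiv.toEmbedding) := by
  refine ⟨(mem_map_iso _ _ _).2 h.1, fun v hv => ?_⟩
  obtain ⟨v, rfl⟩ := g.surjective v
  rw [parent_iso hG, mem_map_iso]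
  exact h.2 v ((mem_map_iso _ _ _).1 hv)

variable {S : Type*} [MeasurableSpace S] [MeasurableSingletonClass S] [Countable S]

/-- For reversible weights the law of the chain is invariant under automorphisms. -/
theorem chainLaw_map_iso [Nonempty S] (hG : G.IsTree) (w : V) {a : S → ℝ}
    {p : S → S → ℝ} (ha : ∀ s, 0 < a s) (ha1 : HasSum a 1) (hp : ∀ s t, 0 ≤ p s t)
    (hp1 : ∀ s, HasSum (p s) 1) (hrev : ∀ s t, a s * p s t = a t * p t s) (g : G ≃g G) :
    (chainLaw G w a p).map (fun σ v => σ (g v)) = chainLaw G w a p := by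
  classical
  have := isProbabilityMeasure_chainLaw (G := G) w (fun s => (ha s).le) ha1 hp hp1
  have hmeas : Measurable fun (σ : V → S) v => σ (g v) :=
    measurable_pi_lambda _ fun v => measurable_pi_apply _
  have := Measure.isProbabilityMeasure_map (μ := chainLaw G w a p) hmeas.aemeasurable
  refine ext_of_cylinders (F := fun Λ => IsRooted G w Λ) (fun I => ?_) fun Λ hΛ t => ?_
  · obtain ⟨Λ, h1, h2⟩ := exists_connected_superset hG (insert w I)
    exact ⟨Λ, fun v hv => h1 (by simp [hv]), isRooted_of_connected hG h2 (h1 (by simp))⟩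
  · rw [Measure.map_apply hmeas (measurableSet_cylinder Λ t)]
    have hset : (fun (σ : V → S) v => σ (g v)) ⁻¹' {σ | ∀ x ∈ Λ, σ x = t x}
        = {σ | ∀ x ∈ Λ.map g.toEquiv.toEmbedding, σ x = t (g.symm x)} := by
      ext σ
      simp only [Set.mem_preimage, Set.mem_ofPred_eq, Finset.forall_mem_map]
      exact forall₂_congr fun x _ => by
        change _ ↔ σ (g x) = t (g.symm (g x))
        rw [RelIso.symm_apply_apply]
    -- The translated cylinder lives on the image of `Λ`, which is rooted at `g w`. Root
    -- independence permits evaluating it there, where it matches the original cylinder vertex by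
    -- vertex.
    rw [hset, chainLaw_root_independent hG w (g w) ha ha1 hp hp1 hrev,
      chainLaw_cylinder hG (fun s => (ha s).le) hp hp1 (isRooted_iso hG g hΛ),
      ← chainLaw_root_independent hG w (g w) ha ha1 hp hp1 hrev,
      chainLaw_cylinder hG (fun s => (ha s).le) hp hp1 hΛ, inner_iso hG, Finset.prod_map]
    simp [parent_iso hG]

end Automorphism

/-! ### Automorphism invariance of the increments -/

section GradientMeasure

variable {V : Type*} {G : SimpleGraph V}

/-- Changing the root reverses some edges, which negates the class and the integer increment
together; `hsymm` says that the weight does not notice. -/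
theorem prod_increments_root_independent {S : Type*} [AddGroup S]
    (hG : G.IsTree) {r : S → ℤ → ℝ}
    (hsymm : ∀ s j, r (-s) (-j) = r s j) (w w' : V) (Λ : Finset V) (σ : V → S) (ω : V → ℤ) :
    ∏ v ∈ inner G w Λ, r (σ v - σ (parent G w v)) (ω v - ω (parent G w v))
      = ∏ v ∈ inner G w' Λ, r (σ v - σ (parent G w' v)) (ω v - ω (parent G w' v)) :=
  prod_inner_root_independent hG w w' Λ (f := fun x y => r (σ y - σ x) (ω y - ω x)) fun x y => by
    rw [← hsymm, neg_sub, neg_sub]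

variable {S : Type*} [AddGroup S] [MeasurableSpace S]
  [MeasurableSingletonClass S] [Countable S]

theorem measurable_prod_increments {r : S → ℤ → ℝ} (J : Finset V) (π : V → V) (ω : V → ℤ) :
    Measurable fun σ : V → S => ENNReal.ofReal
      (∏ v ∈ J, r (σ v - σ (π v)) (ω v - ω (π v))) := by
  refine (Finset.measurable_prod _ fun v _ => ?_).ennreal_ofReal
  have hf : Measurable fun σ : V → S => (σ v, σ (π v)) :=
    (measurable_pi_apply v).prodMk (measurable_pi_apply _)
  exact (measurable_of_countable fun s : S × S => r (s.1 - s.2) (ω v - ω (π v))).comp hf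

theorem incrementMeasure_isAutomorphismInvariant (hG : G.IsTree) [G.LocallyFinite] (w : V)
    {P : Measure (V → S)} [IsProbabilityMeasure P] {r : S → ℤ → ℝ} (hr : ∀ s j, 0 ≤ r s j)
    (hr1 : ∀ s, HasSum (r s) 1) (hsymm : ∀ s j, r (-s) (-j) = r s j)
    (hP : ∀ g : G ≃g G, P.map (fun σ v => σ (g v)) = P) :
    IsAutomorphismInvariant G (incrementMeasure G w P r) := by
  classical
  intro g
  have hri : ∀ i : V × S, IsProbabilityMeasure (law (r i.2)) := fun i =>
    isProbabilityMeasure_law (hr i.2) (hr1 i.2)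
  have hmeas : Measurable fun (η : G.Dart → ℤ) e => η (g.toHom.mapDart e) :=
    measurable_pi_lambda _ fun e => measurable_pi_apply _
  have hgm : Measurable fun (σ : V → S) v => σ (g v) :=
    measurable_pi_lambda _ fun v => measurable_pi_apply _
  have hprob : IsProbabilityMeasure (incrementMeasure G w P r) := by
    have hm : Measurable fun ω : (V → S) × (V × S → ℤ) => grad G (heights G w ω) :=
      measurable_grad.comp (measurable_heights w)
    exact Measure.isProbabilityMeasure_map hm.aemeasurable
  have hprob' := Measure.isProbabilityMeasure_map (μ := incrementMeasure G w P r) hmeas.aemeasurable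
  have hae := incrementMeasure_ae_grad hG w P r
  refine ext_of_gradCylinders (F := fun _ => True) ?_ hae (fun I => ⟨I, subset_rfl, trivial⟩) ?_
  · rw [ae_map_iff hmeas.aemeasurable (measurableSet_gradients hG)]
    filter_upwards [hae] with ζ hζ
    obtain ⟨ω, rfl⟩ := hζ
    exact ⟨fun v => ω (g v), rfl⟩
  · intro Λ _ ω
    have hset : (fun (η : G.Dart → ℤ) e => η (g.toHom.mapDart e)) ⁻¹' gradCylinder G Λ ω
        = gradCylinder G (Λ.map g.toEquiv.toEmbedding) fun v => ω (g.symm v) := by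
      ext η
      simp only [gradCylinder, Set.mem_preimage, Set.mem_ofPred_eq]
      constructor
      · intro h e h1 h2
        obtain ⟨e, rfl⟩ : ∃ e', e = g.toHom.mapDart e' :=
          ⟨g.symm.toHom.mapDart e, SimpleGraph.Dart.ext _ _
            (Prod.ext (g.apply_symm_apply _).symm (g.apply_symm_apply _).symm)⟩
        rw [h e ((mem_map_iso g _ _).1 h1) ((mem_map_iso g _ _).1 h2)]
        change ω e.snd - ω e.fst = ω (g.symm (g e.snd)) - ω (g.symm (g e.fst))
        rw [RelIso.symm_apply_apply, RelIso.symm_apply_apply]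
      · intro h e h1 h2
        rw [h (g.toHom.mapDart e) ((mem_map_iso g _ _).2 h1) ((mem_map_iso g _ _).2 h2)]
        change ω (g.symm (g e.snd)) - ω (g.symm (g e.fst)) = ω e.snd - ω e.fst
        rw [RelIso.symm_apply_apply, RelIso.symm_apply_apply]
    rw [Measure.map_apply hmeas (measurableSet_gradCylinder Λ ω), hset,
      incrementMeasure_gradCylinder hG w hr hr1, incrementMeasure_gradCylinder hG w hr hr1]
    simp only [prod_increments_root_independent hG hsymm w (g w), inner_iso hG, Finset.prod_map]
    -- Invariance of `P` replaces `σ` by `σ ∘ g` in the right-hand integral, so that the two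
    -- integrands agree for every `σ`.
    conv_rhs => rw [← hP g]
    rw [lintegral_map (measurable_prod_increments _ _ _) hgm]
    refine lintegral_congr fun σ => ?_
    simp only [← prod_increments_root_independent hG hsymm w (g w)]
    simp [parent_iso hG]

end GradientMeasure

/-! ### The two-layer measure of a boundary law -/

section TwoLayer

variable {V : Type*} {G : SimpleGraph V} {Q : ℤ → ℝ} {d q : ℕ} [NeZero q] {lam : ZMod q → ℝ}

/-- The law of the fuzzy chain, sampled from the root `w`. -/
def fuzzyChain (G : SimpleGraph V) (w : V) (Q : ℤ → ℝ) (d : ℕ) (lam : ZMod q → ℝ) :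
    Measure (V → ZMod q) :=
  chainLaw G w (fuzzyStationary d lam) (fuzzyTransition Q lam)

/-- The gradient measure associated with `lam`, sampled from the root `w`. -/
def gradientMeasure (G : SimpleGraph V) (w : V) (Q : ℤ → ℝ) (d : ℕ) (lam : ZMod q → ℝ) :
    Measure (G.Dart → ℤ) :=
  incrementMeasure G w (fuzzyChain G w Q d lam) fun s j => rho Q j s

theorem isProbabilityMeasure_fuzzyChain (hpos : ∀ i, 0 < Q i) (hQ : Summable Q)
    (hlam : ∀ s, 0 < lam s) (w : V) : IsProbabilityMeasure (fuzzyChain G w Q d lam) :=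
  isProbabilityMeasure_chainLaw w (fun s => (fuzzyStationary_pos hlam s).le)
    (hasSum_fuzzyStationary hlam) (fuzzyTransition_nonneg hpos hQ hlam)
    (hasSum_fuzzyTransition hpos hQ hlam)

theorem isProbabilityMeasure_gradientMeasure (hpos : ∀ i, 0 < Q i) (hQ : Summable Q)
    (hlam : ∀ s, 0 < lam s) (w : V) : IsProbabilityMeasure (gradientMeasure G w Q d lam) := by
  have := isProbabilityMeasure_fuzzyChain (G := G) (d := d) hpos hQ hlam w
  have hri : ∀ i : V × ZMod q, IsProbabilityMeasure (law fun j => rho Q j i.2) := fun i =>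
    isProbabilityMeasure_law (rho_nonneg hpos hQ i.2) (hasSum_rho hpos hQ i.2)
  have hm : Measurable fun ω : (V → ZMod q) × (V × ZMod q → ℤ) => grad G (heights G w ω) :=
    measurable_grad.comp (measurable_heights w)
  exact Measure.isProbabilityMeasure_map hm.aemeasurable

theorem fuzzyChain_cylinder (hG : G.IsTree) (hpos : ∀ i, 0 < Q i) (hQ : Summable Q)
    (hlam : ∀ s, 0 < lam s) {w : V} {Λ : Finset V} (hΛ : IsRooted G w Λ) (t : V → ZMod q) :
    fuzzyChain G w Q d lam {σ | ∀ x ∈ Λ, σ x = t x}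
      = ENNReal.ofReal (fuzzyStationary d lam (t w) *
        ∏ v ∈ inner G w Λ, fuzzyTransition Q lam (t (parent G w v)) (t v)) :=
  chainLaw_cylinder hG (fun s => (fuzzyStationary_pos hlam s).le)
    (fuzzyTransition_nonneg hpos hQ hlam) (hasSum_fuzzyTransition hpos hQ hlam) hΛ t

theorem fuzzyChain_root_independent (hG : G.IsTree) (heven : ∀ i, Q (-i) = Q i)
    (hpos : ∀ i, 0 < Q i) (hQ : Summable Q) (hd : 1 ≤ d) (h : IsPeriodicBoundaryLaw Q d lam)
    (w w' : V) : fuzzyChain G w Q d lam = fuzzyChain G w' Q d lam :=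
  chainLaw_root_independent hG w w' (fuzzyStationary_pos h.pos) (hasSum_fuzzyStationary h.pos)
    (fuzzyTransition_nonneg hpos hQ h.pos) (hasSum_fuzzyTransition hpos hQ h.pos)
    (fuzzyTransition_reversible heven hpos hQ hd h)

theorem isFuzzyChain_fuzzyChain (hG : G.IsTree) (heven : ∀ i, Q (-i) = Q i)
    (hpos : ∀ i, 0 < Q i) (hQ : Summable Q) (hd : 1 ≤ d) (h : IsPeriodicBoundaryLaw Q d lam)
    (w : V) : IsFuzzyChain G Q d lam (fuzzyChain G w Q d lam) where
  prob := isProbabilityMeasure_fuzzyChain hpos hQ h.pos w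
  marginal Λ hΛ u s := by
    classical
    obtain ⟨t, rfl⟩ : ∃ t : V → ZMod q, s = fun x : Λ => t x :=
      ⟨fun v => if h : v ∈ Λ then s ⟨v, h⟩ else 0, by ext x; simp⟩
    rw [treeProd_eq_prod_inner hG Λ u fun x y => fuzzyTransition Q lam (t x) (t y),
      fuzzyChain_root_independent hG heven hpos hQ hd h w u,
      ← fuzzyChain_cylinder hG hpos hQ h.pos (isRooted_of_connected hG hΛ u.2)]
    congr 1
    ext σ
    simp

theorem lintegral_restrict_eq_sum {S : Type*} [Fintype S] [MeasurableSpace S]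
    [MeasurableSingletonClass S] (P : Measure (V → S)) (Λ : Finset V) [Fintype (Λ → S)]
    (φ : (Λ → S) → ℝ≥0∞) :
    ∫⁻ σ, φ (fun x => σ x) ∂P = ∑ s : Λ → S, P {σ | ∀ x : Λ, σ x = s x} * φ s := by
  classical
  have hm : Measurable (Λ.restrict : (V → S) → Λ → S) := Finset.measurable_restrict Λ
  have h := lintegral_map (μ := P) (measurable_of_countable φ) hm
  have h2 : ∫⁻ σ, φ (fun x => σ x) ∂P = ∫⁻ s, φ s ∂(P.map Λ.restrict) := h.symm
  rw [h2, lintegral_fintype]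
  refine Finset.sum_congr rfl fun s _ => ?_
  rw [Measure.map_apply hm (measurableSet_singleton s), mul_comm]
  congr 2
  ext σ
  simp [funext_iff]

theorem isTwoLayerMeasure_gradientMeasure (hG : G.IsTree) (heven : ∀ i, Q (-i) = Q i)
    (hpos : ∀ i, 0 < Q i) (hQ : Summable Q) (hd : 1 ≤ d) (h : IsPeriodicBoundaryLaw Q d lam)
    (w : V) : IsTwoLayerMeasure G Q d lam (gradientMeasure G w Q d lam) := by
  classical
  have := isProbabilityMeasure_fuzzyChain (G := G) (d := d) hpos hQ h.pos w
  refine ⟨isProbabilityMeasure_gradientMeasure hpos hQ h.pos w, _,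
    isFuzzyChain_fuzzyChain hG heven hpos hQ hd h w, fun Λ u ω => ?_⟩
  rw [← lintegral_restrict_eq_sum (fuzzyChain G w Q d lam) Λ fun s =>
    ENNReal.ofReal (treeProd G Λ u fun x y => rho Q (ω y - ω x) (s y - s x))]
  rw [← gradCylinder, gradientMeasure,
    incrementMeasure_gradCylinder hG w (rho_nonneg hpos hQ) (hasSum_rho hpos hQ)]
  refine lintegral_congr fun σ => ?_
  rw [treeProd_eq_prod_inner hG Λ u fun x y => rho Q (ω y - ω x) (σ y - σ x)]
  congr 1
  exact prod_increments_root_independent hG (r := fun s j => rho Q j s)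
    (fun s j => rho_neg heven j s) w u Λ σ ω

theorem isAutomorphismInvariant_gradientMeasure (hG : G.IsTree) [G.LocallyFinite]
    (heven : ∀ i, Q (-i) = Q i)
    (hpos : ∀ i, 0 < Q i) (hQ : Summable Q) (hd : 1 ≤ d) (h : IsPeriodicBoundaryLaw Q d lam)
    (w : V) : IsAutomorphismInvariant G (gradientMeasure G w Q d lam) := by
  have := isProbabilityMeasure_fuzzyChain (G := G) (d := d) hpos hQ h.pos w
  exact incrementMeasure_isAutomorphismInvariant hG w (rho_nonneg hpos hQ) (hasSum_rho hpos hQ)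
    (fun s j => rho_neg heven j s) fun g =>
      chainLaw_map_iso hG w (fuzzyStationary_pos h.pos) (hasSum_fuzzyStationary h.pos)
        (fuzzyTransition_nonneg hpos hQ h.pos) (hasSum_fuzzyTransition hpos hQ h.pos)
        (fuzzyTransition_reversible heven hpos hQ hd h) g

/-- The root independence of the gradient measure. -/
theorem gradientMeasure_root_independent (hG : G.IsTree) [G.LocallyFinite]
    (heven : ∀ i, Q (-i) = Q i)
    (hpos : ∀ i, 0 < Q i) (hQ : Summable Q) (hd : 1 ≤ d) (h : IsPeriodicBoundaryLaw Q d lam)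
    (w w' : V) : gradientMeasure G w Q d lam = gradientMeasure G w' Q d lam := by
  have := isProbabilityMeasure_fuzzyChain (G := G) (d := d) hpos hQ h.pos w
  have := isProbabilityMeasure_gradientMeasure (G := G) (d := d) hpos hQ h.pos w
  refine ext_of_gradCylinders (F := fun _ => True) (incrementMeasure_ae_grad hG w _ _)
    (incrementMeasure_ae_grad hG w' _ _) (fun I => ⟨I, subset_rfl, trivial⟩) fun Λ _ ω => ?_
  rw [gradientMeasure, gradientMeasure,
    ← fuzzyChain_root_independent hG heven hpos hQ hd h w w',
    incrementMeasure_gradCylinder hG w (rho_nonneg hpos hQ) (hasSum_rho hpos hQ),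
    incrementMeasure_gradCylinder hG w' (rho_nonneg hpos hQ) (hasSum_rho hpos hQ)]
  refine lintegral_congr fun σ => ?_
  rw [prod_increments_root_independent hG (r := fun s j => rho Q j s)
    (fun s j => rho_neg heven j s) w w' Λ σ ω]

/-- The boundary weight of a configuration of residue classes on a rooted set of vertices. -/
def boundaryWeight (G : SimpleGraph V) (w : V) (Q : ℤ → ℝ) (lam : ZMod q → ℝ) (Λ : Finset V)
    (t : V → ZMod q) : ℝ :=
  lam (t w) * fuzzyNorm Q lam (t w) *
    ∏ v ∈ inner G w Λ, lam (t v) / fuzzyNorm Q lam (t (parent G w v))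

theorem boundaryWeight_pos (hpos : ∀ i, 0 < Q i) (hQ : Summable Q) (hlam : ∀ s, 0 < lam s)
    (w : V) (Λ : Finset V) (t : V → ZMod q) : 0 < boundaryWeight G w Q lam Λ t :=
  mul_pos (mul_pos (hlam _) (fuzzyNorm_pos hpos hQ hlam _))
    (Finset.prod_pos fun _ _ => div_pos (hlam _) (fuzzyNorm_pos hpos hQ hlam _))

/-- The probability of a gradient cylinder over a rooted set. -/
theorem gradientMeasure_gradCylinder (hG : G.IsTree) (heven : ∀ i, Q (-i) = Q i)
    (hpos : ∀ i, 0 < Q i) (hQ : Summable Q) {κ : ℝ}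
    (hlam : ∀ s, 0 < lam s)
    (hκ : ∀ s, fuzzyStationary d lam s = κ * (lam s * fuzzyNorm Q lam s))
    {w : V} {Λ : Finset V} (hΛ : IsRooted G w Λ) (a : V → ℤ) :
    gradientMeasure G w Q d lam (gradCylinder G Λ a) = ENNReal.ofReal
      ((∏ v ∈ inner G w Λ, Q (a v - a (parent G w v))) *
        ∑ k : ZMod q, κ * boundaryWeight G w Q lam Λ fun v => (a v : ZMod q) + k) := by
  classical
  have := isProbabilityMeasure_fuzzyChain (G := G) (d := d) hpos hQ hlam w
  rw [gradientMeasure,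
    incrementMeasure_gradCylinder hG w (rho_nonneg hpos hQ) (hasSum_rho hpos hQ)]
  set B : ℝ := ∏ v ∈ inner G w Λ, Q (a v - a (parent G w v))
    / fuzzyQ Q ((a v : ZMod q) - (a (parent G w v) : ZMod q)) with hB
  have hB0 : 0 ≤ B := Finset.prod_nonneg fun v _ => div_nonneg (hpos _).le (fuzzyQ_pos hQ hpos _).le
  set C : ZMod q → Set (V → ZMod q) := fun k => {σ | ∀ x ∈ Λ, σ x = (a x : ZMod q) + k} with hC
  -- The weight is nonzero only if every class increment of `σ` is that of `a`. On a rooted set this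
  -- means `σ = a + k` for a single class `k`, the difference at the root, so the integrand is a
  -- finite sum of indicators.
  have hint : ∀ σ : V → ZMod q, ENNReal.ofReal
      (∏ v ∈ inner G w Λ, rho Q (a v - a (parent G w v)) (σ v - σ (parent G w v)))
      = ∑ k, (C k).indicator (fun _ => ENNReal.ofReal B) σ := by
    intro σ
    by_cases hσ : ∃ k, σ ∈ C k
    · obtain ⟨k, hk⟩ := hσ
      rw [Finset.sum_eq_single k]
      · rw [Set.indicator_of_mem hk, hB]
        congr 1
        refine Finset.prod_congr rfl fun v hv => ?_
        rw [inner_of_isRooted hΛ] at hv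
        have hv' := Finset.mem_of_mem_erase hv
        rw [hk v hv', hk _ (hΛ.2 v hv'), add_sub_add_right_eq_sub, rho, if_pos (by push_cast; rfl)]
      · intro k' _ hk'
        refine Set.indicator_of_notMem (fun h => hk' ?_) _
        have h1 := h w hΛ.1
        rw [hk w hΛ.1] at h1
        exact (add_left_cancel h1).symm
      · simp
    · rw [Finset.sum_eq_zero fun k _ => Set.indicator_of_notMem (fun h => hσ ⟨k, h⟩) _]
      rw [ENNReal.ofReal_eq_zero]
      refine le_of_eq ?_
      by_contra hne
      refine hσ ⟨σ w - a w, ?_⟩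
      refine fun x => tree_induction hG w (P := fun x => x ∈ Λ → σ x = (a x : ZMod q) + (σ w - a w))
        (fun _ => by abel) (fun v hv ih hvΛ => ?_) x
      have h1 := Finset.prod_ne_zero_iff.1 hne v
        (by rw [inner_of_isRooted hΛ]; exact Finset.mem_erase.2 ⟨hv, hvΛ⟩)
      have h2 : ((a v - a (parent G w v) : ℤ) : ZMod q) = σ v - σ (parent G w v) := by
        by_contra h
        exact h1 (if_neg h)
      rw [ih (hΛ.2 v hvΛ)] at h2
      push_cast at h2
      rw [eq_sub_iff_add_eq] at h2
      rw [← h2]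
      abel
  have hCm : ∀ k, MeasurableSet (C k) := fun k => measurableSet_cylinder _ _
  simp only [hint]
  rw [lintegral_finsetSum _ fun k _ => measurable_const.indicator (hCm k), Finset.mul_sum,
    ENNReal.ofReal_sum_of_nonneg]
  · refine Finset.sum_congr rfl fun k _ => ?_
    rw [lintegral_indicator_const (hCm k), hC]
    simp only
    rw [fuzzyChain_cylinder hG hpos hQ hlam hΛ fun v => (a v : ZMod q) + k, ← ENNReal.ofReal_mul hB0]
    congr 1
    rw [hκ, boundaryWeight, hB]
    -- On each edge the denominator `Q_q` of `rho` cancels the numerator `Q_q` of the transition.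
    -- The two arguments differ by a sign, hence evenness.
    have hprod : (∏ v ∈ inner G w Λ, Q (a v - a (parent G w v))
          / fuzzyQ Q ((a v : ZMod q) - (a (parent G w v) : ZMod q)))
        * ∏ v ∈ inner G w Λ, fuzzyTransition Q lam ((a (parent G w v) : ZMod q) + k) ((a v : ZMod q) + k)
        = (∏ v ∈ inner G w Λ, Q (a v - a (parent G w v))) * ∏ v ∈ inner G w Λ,
          lam ((a v : ZMod q) + k) / fuzzyNorm Q lam ((a (parent G w v) : ZMod q) + k) := by
      rw [← Finset.prod_mul_distrib, ← Finset.prod_mul_distrib]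
      refine Finset.prod_congr rfl fun v _ => ?_
      rw [fuzzyTransition, ← fuzzyNorm, add_sub_add_right_eq_sub,
        ← neg_sub (a v : ZMod q), fuzzyQ_neg heven]
      have := (fuzzyQ_pos hQ hpos ((a v : ZMod q) - (a (parent G w v) : ZMod q))).ne'
      field_simp
    linear_combination (κ * (lam (↑(a w) + k) * fuzzyNorm Q lam (↑(a w) + k))) * hprod
  · intro k _
    refine mul_nonneg (Finset.prod_nonneg fun v _ => (hpos _).le) ?_
    have h1 := hκ ((a w : ZMod q) + k)
    have h2 := fuzzyStationary_pos (d := d) hlam ((a w : ZMod q) + k)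
    rw [boundaryWeight, ← mul_assoc, ← h1]
    exact mul_nonneg h2.le
      (Finset.prod_nonneg fun _ _ => div_nonneg (hlam _).le (fuzzyNorm_pos hpos hQ hlam _).le)

end TwoLayer

/-! ### The Gibbs kernels and a criterion for the DLR equation -/

section Specification

variable {V : Type*} {G : SimpleGraph V} {Q : ℤ → ℝ}

theorem glue_of_mem {Λ : Finset V} (τ : Λ → ℤ) (ω : V → ℤ) {x : V} (h : x ∈ Λ) :
    glue Λ τ ω x = τ ⟨x, h⟩ := dif_pos h

theorem glue_of_notMem {Λ : Finset V} (τ : Λ → ℤ) (ω : V → ℤ) {x : V} (h : x ∉ Λ) :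
    glue Λ τ ω x = ω x := dif_neg h

theorem measurable_glue (Λ : Finset V) (τ : Λ → ℤ) : Measurable (glue Λ τ) := by
  refine measurable_pi_lambda _ fun x => ?_
  by_cases h : x ∈ Λ
  · simp only [glue_of_mem τ _ h]
    exact measurable_const
  · simp only [glue_of_notMem τ _ h]
    exact measurable_pi_apply x

theorem edgeWeight_mk (heven : ∀ i, Q (-i) = Q i) (ω : V → ℤ) (x y : V) :
    edgeWeight Q ω s(x, y) = Q (ω y - ω x) := by
  simp only [edgeWeight, Sym2.lift_mk]
  rcases abs_choice (ω x - ω y) with h | h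
  · rw [h, ← heven, neg_sub]
  · rw [h, neg_sub]

theorem edgeWeight_pos (hpos : ∀ i, 0 < Q i) (ω : V → ℤ) (b : Sym2 V) :
    0 < edgeWeight Q ω b := by
  induction b using Sym2.ind with
  | _ x y => exact hpos _

theorem edgeWeight_congr {ω ω' : V → ℤ} {x y : V} (h : ω x - ω y = ω' x - ω' y) :
    edgeWeight Q ω s(x, y) = edgeWeight Q ω' s(x, y) := by
  simp only [edgeWeight, Sym2.lift_mk, h]

theorem measurable_edgeWeight (b : Sym2 V) : Measurable fun ω : V → ℤ => edgeWeight Q ω b := by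
  induction b using Sym2.ind with
  | _ x y =>
    exact (measurable_of_countable fun i : ℤ => Q |i|).comp
      ((measurable_pi_apply x).sub (measurable_pi_apply y))

variable [G.LocallyFinite]

open Classical in
/-- The edges which meet `Λ`. -/
def edgesMeeting (G : SimpleGraph V) [G.LocallyFinite] (Λ : Finset V) : Finset (Sym2 V) :=
  Λ.biUnion fun x => G.incidenceFinset x

open Classical in
/-- The edges inside `Λ` which do not meet `Λ₀`. -/
def edgesAvoiding (G : SimpleGraph V) [G.LocallyFinite] (Λ₀ Λ : Finset V) : Finset (Sym2 V) :=
  edgesIn G Λ \ edgesMeeting G Λ₀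

theorem mem_edgesMeeting {Λ : Finset V} {x y : V} :
    s(x, y) ∈ edgesMeeting G Λ ↔ G.Adj x y ∧ (x ∈ Λ ∨ y ∈ Λ) := by
  classical
  simp only [edgesMeeting, Finset.mem_biUnion, SimpleGraph.mem_incidenceFinset,
    SimpleGraph.mk'_mem_incidenceSet_iff]
  constructor
  · rintro ⟨z, hz, h, rfl | rfl⟩
    exacts [⟨h, Or.inl hz⟩, ⟨h, Or.inr hz⟩]
  · rintro ⟨h, hx | hy⟩
    exacts [⟨x, hx, h, Or.inl rfl⟩, ⟨y, hy, h, Or.inr rfl⟩]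

theorem boltzmannWeight_eq (Λ : Finset V) (σ : V → ℤ) :
    boltzmannWeight G Q Λ σ = ∏ b ∈ edgesMeeting G Λ, edgeWeight Q σ b := rfl

theorem boltzmannWeight_pos (hpos : ∀ i, 0 < Q i) (Λ : Finset V) (σ : V → ℤ) :
    0 < boltzmannWeight G Q Λ σ :=
  Finset.prod_pos fun b _ => edgeWeight_pos hpos σ b

theorem boltzmannWeight_congr {Λ : Finset V} {σ σ' : V → ℤ}
    (h : ∀ x y, G.Adj x y → x ∈ Λ → σ x - σ y = σ' x - σ' y) :
    boltzmannWeight G Q Λ σ = boltzmannWeight G Q Λ σ' := by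
  rw [boltzmannWeight_eq, boltzmannWeight_eq]
  refine Finset.prod_congr rfl fun b hb => ?_
  induction b using Sym2.ind with
  | _ x y =>
    rw [mem_edgesMeeting] at hb
    rcases hb with ⟨hxy, hx | hy⟩
    · exact edgeWeight_congr (h x y hxy hx)
    · rw [Sym2.eq_swap]
      exact edgeWeight_congr (h y x hxy.symm hy)

theorem measurable_boltzmannWeight (Λ : Finset V) :
    Measurable fun σ : V → ℤ => boltzmannWeight G Q Λ σ :=
  Finset.measurable_prod _ fun b _ => measurable_edgeWeight b

theorem measurable_partitionFunction (Λ : Finset V) :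
    Measurable fun ω : V → ℤ => partitionFunction G Q Λ ω :=
  Measurable.tsum fun τ =>
    ((measurable_boltzmannWeight Λ).comp (measurable_glue Λ τ)).ennreal_ofReal

theorem gibbsKernel_apply (Λ : Finset V) (ω : V → ℤ) {A : Set (V → ℤ)} (hA : MeasurableSet A) :
    gibbsKernel G Q Λ ω A = ∑' τ : Λ → ℤ,
      ENNReal.ofReal (boltzmannWeight G Q Λ (glue Λ τ ω)) / partitionFunction G Q Λ ω *
        A.indicator 1 (glue Λ τ ω) := by
  rw [gibbsKernel, Measure.sum_apply _ hA]
  refine tsum_congr fun τ => ?_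
  rw [Measure.smul_apply, Measure.dirac_apply' _ hA, smul_eq_mul]

theorem measurable_gibbsKernel (Λ : Finset V) :
    Measurable fun ω : V → ℤ => gibbsKernel G Q Λ ω := by
  refine Measure.measurable_of_measurable_coe _ fun A hA => ?_
  simp only [gibbsKernel_apply Λ _ hA]
  refine Measurable.tsum fun τ => Measurable.mul ?_ ?_
  · exact ((measurable_boltzmannWeight Λ).comp (measurable_glue Λ τ)).ennreal_ofReal.div
      (measurable_partitionFunction Λ)
  · exact (measurable_one.indicator hA).comp (measurable_glue Λ τ)

theorem glue_sub_const (Λ : Finset V) (τ : Λ → ℤ) (ω : V → ℤ) (k : ℤ) :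
    glue Λ (fun x => τ x - k) (fun v => ω v - k) = fun v => glue Λ τ ω v - k := by
  ext v
  by_cases h : v ∈ Λ
  · rw [glue_of_mem _ _ h, glue_of_mem _ _ h]
  · rw [glue_of_notMem _ _ h, glue_of_notMem _ _ h]

theorem boltzmannWeight_sub_const (Λ : Finset V) (σ : V → ℤ) (k : ℤ) :
    boltzmannWeight G Q Λ (fun v => σ v - k) = boltzmannWeight G Q Λ σ :=
  boltzmannWeight_congr fun x y _ _ => by ring

theorem partitionFunction_sub_const (Λ : Finset V) (ω : V → ℤ) (k : ℤ) :
    partitionFunction G Q Λ (fun v => ω v - k) = partitionFunction G Q Λ ω := by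
  rw [partitionFunction, partitionFunction, ← (Equiv.subRight fun _ : Λ => k).tsum_eq]
  refine tsum_congr fun τ => ?_
  change ENNReal.ofReal (boltzmannWeight G Q Λ (glue Λ (fun x => τ x - k) _)) = _
  rw [glue_sub_const, boltzmannWeight_sub_const]

/-- The image of the Gibbs kernel under the gradient is invariant under height shifts. -/
theorem gibbsKernel_sub_const (Λ : Finset V) (ω : V → ℤ) (k : ℤ) {A : Set (G.Dart → ℤ)}
    (hA : MeasurableSet A) :
    gibbsKernel G Q Λ (fun v => ω v - k) (grad G ⁻¹' A) = gibbsKernel G Q Λ ω (grad G ⁻¹' A) := by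
  rw [gibbsKernel_apply Λ _ (measurable_grad hA), gibbsKernel_apply Λ _ (measurable_grad hA),
    ← (Equiv.subRight fun _ : Λ => k).tsum_eq]
  refine tsum_congr fun τ => ?_
  change ENNReal.ofReal (boltzmannWeight G Q Λ (glue Λ (fun x => τ x - k) _)) / _ *
    (grad G ⁻¹' A).indicator 1 (glue Λ (fun x => τ x - k) _) = _
  rw [glue_sub_const, boltzmannWeight_sub_const, partitionFunction_sub_const]
  congr 1
  have : (fun v => glue Λ τ ω v - k) ∈ grad G ⁻¹' A ↔ glue Λ τ ω ∈ grad G ⁻¹' A := by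
    rw [Set.mem_preimage, grad_sub_const, Set.mem_preimage]
  by_cases h : glue Λ τ ω ∈ grad G ⁻¹' A
  · rw [Set.indicator_of_mem h, Set.indicator_of_mem (this.2 h)]; rfl
  · rw [Set.indicator_of_notMem h, Set.indicator_of_notMem fun h' => h (this.1 h')]

/-- The height configuration chosen in the kernel differs from the pinned one by a constant, to
which the gradient image is blind. This replaces an arbitrary choice by a measurable function of
`ζ`. -/
theorem gradientKernel_apply (hG : G.IsTree) (o : V) (Λ : Finset V) {ζ : G.Dart → ℤ}
    (hζ : ∃ ω : V → ℤ, grad G ω = ζ) {A : Set (G.Dart → ℤ)} (hA : MeasurableSet A) :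
    gradientKernel G Q Λ ζ A = gibbsKernel G Q Λ (pinnedHeights G o ζ) (grad G ⁻¹' A) := by
  rw [gradientKernel, dif_pos hζ, Measure.map_apply measurable_grad hA]
  have h : pinnedHeights G o ζ = fun v => hζ.choose v - hζ.choose o := by
    conv_lhs => rw [← hζ.choose_spec]
    exact funext (pinnedHeights_grad hG o _)
  rw [h, gibbsKernel_sub_const Λ _ _ hA]

/-- A set of vertices which contains a set together with its neighbours. -/
def ContainsNeighbours (G : SimpleGraph V) (Λ₀ Λ : Finset V) : Prop :=
  Λ₀ ⊆ Λ ∧ ∀ x ∈ Λ₀, ∀ y, G.Adj x y → y ∈ Λ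

theorem boltzmannWeight_congr_of_eqOn {Λ₀ Λ : Finset V} (hΛ : ContainsNeighbours G Λ₀ Λ)
    {σ σ' : V → ℤ} (h : ∀ x ∈ Λ, σ x = σ' x) :
    boltzmannWeight G Q Λ₀ σ = boltzmannWeight G Q Λ₀ σ' :=
  boltzmannWeight_congr fun x y hxy hx => by rw [h x (hΛ.1 hx), h y (hΛ.2 x hx y hxy)]

/-- The Gibbs kernel of a cylinder event. -/
theorem gibbsKernel_cylinder {Λ₀ Λ : Finset V} (hΛ : ContainsNeighbours G Λ₀ Λ) (a ω : V → ℤ) :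
    gibbsKernel G Q Λ₀ ω {σ | ∀ x ∈ Λ, σ x = a x}
      = {σ : V → ℤ | ∀ x ∈ Λ, x ∉ Λ₀ → σ x = a x}.indicator
        (fun _ => ENNReal.ofReal (boltzmannWeight G Q Λ₀ a) / partitionFunction G Q Λ₀ a) ω := by
  rw [gibbsKernel_apply Λ₀ _ (measurableSet_cylinder Λ a)]
  by_cases hω : ∀ x ∈ Λ, x ∉ Λ₀ → ω x = a x
  · rw [Set.indicator_of_mem (by exact hω), tsum_eq_single fun x : Λ₀ => a x]
    · have hglue : ∀ τ : Λ₀ → ℤ, ∀ x ∈ Λ, glue Λ₀ τ ω x = glue Λ₀ τ a x := by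
        intro τ x hx
        by_cases h : x ∈ Λ₀
        · rw [glue_of_mem _ _ h, glue_of_mem _ _ h]
        · rw [glue_of_notMem _ _ h, glue_of_notMem _ _ h, hω x hx h]
      have hself : glue Λ₀ (fun x : Λ₀ => a x) a = a := by
        ext x
        by_cases h : x ∈ Λ₀
        · rw [glue_of_mem _ _ h]
        · rw [glue_of_notMem _ _ h]
      -- All edges meeting `Λ₀` lie inside `Λ`, so the partition function sees `ω` only where it
      -- agrees with `a`.
      have hZ : partitionFunction G Q Λ₀ ω = partitionFunction G Q Λ₀ a :=
        tsum_congr fun τ => by rw [boltzmannWeight_congr_of_eqOn hΛ (hglue τ)]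
      rw [Set.indicator_of_mem, boltzmannWeight_congr_of_eqOn hΛ (hglue _), hself, hZ,
        Pi.one_apply, mul_one]
      intro x hx
      rw [hglue _ x hx, hself]
    · intro τ hτ
      rw [Set.indicator_of_notMem, mul_zero]
      intro h
      refine hτ (funext fun x => ?_)
      rw [← h x (hΛ.1 x.2), glue_of_mem _ _ x.2]
  · rw [Set.indicator_of_notMem (by exact hω), ENNReal.tsum_eq_zero]
    intro τ
    rw [Set.indicator_of_notMem, mul_zero]
    intro h
    exact hω fun x hx hx₀ => by rw [← h x hx, glue_of_notMem _ _ hx₀]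

/-- A measure on heights whose cylinder probabilities factorize satisfies the DLR equation. -/
theorem bind_gibbsKernel (hpos : ∀ i, 0 < Q i) {m : Measure (V → ℤ)} [IsProbabilityMeasure m]
    {Λ₀ : Finset V} {o : V} (ho : o ∉ Λ₀) (hmo : ∀ᵐ ω ∂m, ω o = 0)
    {F : Finset V → Prop} (hF : ∀ I, ∃ J, I ⊆ J ∧ F J)
    (hfac : ∀ Λ, F Λ → ContainsNeighbours G Λ₀ Λ ∧ o ∈ Λ ∧ ∃ R : (V → ℤ) → ℝ, (∀ a, 0 < R a) ∧
      (∀ a b : V → ℤ, (∀ x, x ∉ Λ₀ → a x = b x) → R a = R b) ∧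
      ∀ a : V → ℤ, a o = 0 →
        m {σ | ∀ x ∈ Λ, σ x = a x} = ENNReal.ofReal (boltzmannWeight G Q Λ₀ a * R a)) :
    m.bind (gibbsKernel G Q Λ₀) = m := by
  refine (ext_of_cylinders hF fun Λ hΛ a => ?_).symm
  obtain ⟨hnb, hoΛ, R, hR, hRc, hm⟩ := hfac Λ hΛ
  set D : Set (V → ℤ) := {σ | ∀ x ∈ Λ, x ∉ Λ₀ → σ x = a x} with hD
  have hDU : D = ⋃ τ : Λ₀ → ℤ, {σ | ∀ x ∈ Λ, σ x = glue Λ₀ τ a x} := by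
    ext σ
    simp only [hD, Set.mem_ofPred_eq, Set.mem_iUnion]
    constructor
    · refine fun h => ⟨fun x => σ x, fun x hx => ?_⟩
      by_cases h₀ : x ∈ Λ₀
      · rw [glue_of_mem _ _ h₀]
      · rw [glue_of_notMem _ _ h₀, h x hx h₀]
    · rintro ⟨τ, h⟩ x hx h₀
      rw [h x hx, glue_of_notMem _ _ h₀]
  have hDm : MeasurableSet D := by
    rw [hDU]
    exact MeasurableSet.iUnion fun τ => measurableSet_cylinder _ _
  rw [Measure.bind_apply (measurableSet_cylinder Λ a) (measurable_gibbsKernel Λ₀).aemeasurable]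
  simp only [gibbsKernel_cylinder hnb]
  rw [lintegral_indicator_const hDm]
  by_cases hao : a o = 0
  -- Summing the factorized probabilities over the values on `Λ₀` turns the Boltzmann weights into
  -- the partition function, while `R` and the pinned value at `o` stay fixed.
  · have hmD : m D = partitionFunction G Q Λ₀ a * ENNReal.ofReal (R a) := by
      rw [hDU, measure_iUnion _ fun τ => measurableSet_cylinder _ _, partitionFunction,
        ← ENNReal.tsum_mul_right]
      · refine tsum_congr fun τ => ?_
        rw [hm _ (by rw [glue_of_notMem _ _ ho, hao]),
          ENNReal.ofReal_mul (boltzmannWeight_pos hpos _ _).le,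
          hRc (glue Λ₀ τ a) a fun x hx => glue_of_notMem _ _ hx]
      · intro τ τ' hne
        refine Set.disjoint_left.2 fun σ h h' => hne (funext fun x => ?_)
        have h1 := h x (hnb.1 x.2)
        rw [h' x (hnb.1 x.2), glue_of_mem _ _ x.2, glue_of_mem _ _ x.2] at h1
        exact h1.symm
    have hR0 : ENNReal.ofReal (R a) ≠ 0 := by simpa using hR a
    have hZ0 : partitionFunction G Q Λ₀ a ≠ 0 := by
      intro h
      rw [partitionFunction, ENNReal.tsum_eq_zero] at h
      have := h 0
      rw [ENNReal.ofReal_eq_zero] at this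
      exact absurd (boltzmannWeight_pos hpos _ _) this.not_gt
    -- Finiteness of the partition function comes from `m D` being finite and `R a` positive.
    have hZt : partitionFunction G Q Λ₀ a ≠ ∞ := by
      intro h
      rw [h, ENNReal.top_mul hR0] at hmD
      exact measure_ne_top m D hmD
    rw [hm a hao, hmD, ENNReal.ofReal_mul (boltzmannWeight_pos hpos _ _).le, ← mul_assoc,
      ENNReal.div_mul_cancel hZ0 hZt]
  -- If `a o ≠ 0`, both events contradict the pinning at `o` and are null.
  · have hnull : ∀ s : Set (V → ℤ), (∀ σ ∈ s, σ o = a o) → m s = 0 := fun s hs =>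
      measure_mono_null (fun σ hσ => fun h : σ o = 0 => hao (by rw [← hs σ hσ, h])) hmo
    rw [hnull {σ | ∀ x ∈ Λ, σ x = a x} fun σ hσ => hσ o hoΛ, hnull D fun σ hσ => hσ o hoΛ ho, mul_zero]

end Specification

/-! ### The gradient measure satisfies the DLR equation -/

section DLR

variable {V : Type*} {G : SimpleGraph V} {Q : ℤ → ℝ} {d q : ℕ} [NeZero q] {lam : ZMod q → ℝ}

/-- The boundary weight does not depend on the values at vertices all of whose neighbours are
present. -/
theorem boundaryWeight_congr [G.LocallyFinite] (hG : G.IsTree) (hpos : ∀ i, 0 < Q i)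
    (hQ : Summable Q) (hreg : G.IsRegularOfDegree (d + 1)) (h : IsPeriodicBoundaryLaw Q d lam)
    {w : V} {Λ₀ Λ : Finset V} (hw : w ∉ Λ₀) (hΛ : IsRooted G w Λ)
    (hnb : ContainsNeighbours G Λ₀ Λ) {t t' : V → ZMod q} (htt : ∀ x, x ∉ Λ₀ → t x = t' x) :
    boundaryWeight G w Q lam Λ t = boundaryWeight G w Q lam Λ t' := by
  classical
  obtain ⟨c, hc, hcd⟩ := h.exists_eq_pow hQ
  set K : V → ℕ := fun x => ((Λ.erase w).filter fun v => parent G w v = x).card with hK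
  -- Regroup the denominators by parent: `fuzzyNorm` at `x` occurs once per child of `x` in `Λ`. A
  -- vertex of `Λ₀` is not the root and has all `d` children in `Λ`, so the boundary law equation
  -- turns its `lam` over these factors into the constant `c`.
  have key : ∀ t : V → ZMod q, boundaryWeight G w Q lam Λ t
      = lam (t w) * fuzzyNorm Q lam (t w) * (c ^ Λ₀.card * ((∏ v ∈ Λ.erase w \ Λ₀, lam (t v)) /
        ∏ x ∈ Λ \ Λ₀, fuzzyNorm Q lam (t x) ^ K x)) := by
    intro t
    have hN := fun s => fuzzyNorm_pos hpos hQ h.pos s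
    rw [boundaryWeight, inner_of_isRooted hΛ, Finset.prod_div_distrib]
    congr 1
    have h1 : ∏ v ∈ Λ.erase w, fuzzyNorm Q lam (t (parent G w v))
        = ∏ x ∈ Λ, fuzzyNorm Q lam (t x) ^ K x := by
      rw [← Finset.prod_fiberwise_of_maps_to (g := parent G w) (t := Λ)
        (fun v hv => hΛ.2 v (Finset.mem_of_mem_erase hv))]
      refine Finset.prod_congr rfl fun x _ => ?_
      rw [hK, ← Finset.prod_const]
      exact Finset.prod_congr rfl fun v hv => by rw [(Finset.mem_filter.1 hv).2]
    have hsub : Λ₀ ⊆ Λ.erase w := fun x hx =>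
      Finset.mem_erase.2 ⟨fun h => hw (h ▸ hx), hnb.1 hx⟩
    have h2 : ∏ v ∈ Λ₀, lam (t v) = c ^ Λ₀.card * ∏ x ∈ Λ₀, fuzzyNorm Q lam (t x) ^ K x := by
      rw [← Finset.prod_const, ← Finset.prod_mul_distrib]
      refine Finset.prod_congr rfl fun x hx => ?_
      have : K x = d := by
        simp only [hK]
        have hxw : x ≠ w := fun e => hw (e ▸ hx)
        rw [card_children hG hreg (hnb.2 x hx), if_neg hxw]
      rw [hcd, this]
    rw [h1, ← Finset.prod_sdiff hsub, ← Finset.prod_sdiff hnb.1, h2]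
    have h3 : ∏ x ∈ Λ₀, fuzzyNorm Q lam (t x) ^ K x ≠ 0 :=
      Finset.prod_ne_zero_iff.2 fun x _ => pow_ne_zero _ (hN _).ne'
    have h4 : ∏ x ∈ Λ \ Λ₀, fuzzyNorm Q lam (t x) ^ K x ≠ 0 :=
      Finset.prod_ne_zero_iff.2 fun x _ => pow_ne_zero _ (hN _).ne'
    field_simp
  rw [key, key, htt w hw]
  congr 3
  · exact Finset.prod_congr rfl fun x hx => by rw [htt x (Finset.mem_sdiff.1 hx).2]
  · exact Finset.prod_congr rfl fun x hx => by rw [htt x (Finset.mem_sdiff.1 hx).2]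

/-- All edges meeting `Λ₀` lie in `Λ`. The product over the edges of `Λ` therefore splits into the
Boltzmann weight of `Λ₀` and edges untouched by resampling. -/
theorem prod_inner_eq_boltzmannWeight_mul [G.LocallyFinite] (hG : G.IsTree)
    (heven : ∀ i, Q (-i) = Q i) (w : V) {Λ₀ Λ : Finset V}
    (hnb : ContainsNeighbours G Λ₀ Λ) (a : V → ℤ) :
    ∏ v ∈ inner G w Λ, Q (a v - a (parent G w v)) = boltzmannWeight G Q Λ₀ a *
      ∏ b ∈ edgesAvoiding G Λ₀ Λ, edgeWeight Q a b := by
  classical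
  have hsub : edgesMeeting G Λ₀ ⊆ edgesIn G Λ := by
    intro b hb
    induction b using Sym2.ind with
    | _ x y =>
      rw [mem_edgesMeeting] at hb
      rw [mem_edgesIn]
      rcases hb with ⟨hxy, hx | hy⟩
      · exact ⟨hxy, hnb.1 hx, hnb.2 x hx y hxy⟩
      · exact ⟨hxy, hnb.2 y hy x hxy.symm, hnb.1 hy⟩
  simp only [← edgeWeight_mk heven]
  rw [prod_inner_eq_prod_edgesIn hG w Λ (edgeWeight Q a), boltzmannWeight_eq,
    ← Finset.prod_sdiff hsub, mul_comm, edgesAvoiding]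

/-- Pinning the heights at a vertex outside the resampled volume lifts the gradient measure to a
probability measure on heights, where `bind_gibbsKernel` applies; taking gradients again returns the
original measure. -/
theorem isGradientGibbsMeasure_gradientMeasure (hG : G.IsTree) [G.LocallyFinite]
    (hreg : G.IsRegularOfDegree (d + 1)) (heven : ∀ i, Q (-i) = Q i)
    (hpos : ∀ i, 0 < Q i) (hQ : Summable Q) (hd : 1 ≤ d) (h : IsPeriodicBoundaryLaw Q d lam)
    (w : V) : IsGradientGibbsMeasure G Q (gradientMeasure G w Q d lam) where
  prob := isProbabilityMeasure_gradientMeasure hpos hQ h.pos w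
  gradient := incrementMeasure_ae_grad hG w _ _
  dlr := by
    classical
    intro Λ₀ A hA
    have := infinite_of_regular hG hd hreg
    -- The vertex `o` serves both as root and as pin. Outside `Λ₀` it is not resampled, and every
    -- vertex of `Λ₀` has exactly `d` children.
    obtain ⟨o, ho⟩ := Infinite.exists_notMem_finset Λ₀
    rw [gradientMeasure_root_independent hG heven hpos hQ hd h w o]
    set ν := gradientMeasure G o Q d lam with hν
    have hprob : IsProbabilityMeasure ν := isProbabilityMeasure_gradientMeasure hpos hQ h.pos o
    have hgrad : ∀ᵐ ζ ∂ν, ∃ ω : V → ℤ, grad G ω = ζ := incrementMeasure_ae_grad hG o _ _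
    have hpin := measurable_pinnedHeights (G := G) o
    set m := ν.map (pinnedHeights G o) with hm
    have hmprob : IsProbabilityMeasure m := Measure.isProbabilityMeasure_map hpin.aemeasurable
    obtain ⟨κ, hκ0, hκ⟩ := exists_fuzzyStationary_eq hpos hQ hd h
    have hbind : m.bind (gibbsKernel G Q Λ₀) = m := by
      refine bind_gibbsKernel hpos ho ?_
        (F := fun Λ => IsRooted G o Λ ∧ ContainsNeighbours G Λ₀ Λ) (fun I => ?_) ?_
      · rw [hm, ae_map_iff hpin.aemeasurable
          (measurableSet_eq_fun (measurable_pi_apply o) measurable_const)]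
        exact Filter.Eventually.of_forall fun ζ => by rw [pinnedHeights, treeRec_root]
      · obtain ⟨Λ, h1, h2⟩ := exists_connected_superset hG
          (insert o (I ∪ Λ₀ ∪ Λ₀.biUnion fun x => G.neighborFinset x))
        refine ⟨Λ, fun x hx => h1 (by simp [hx]), isRooted_of_connected hG h2 (h1 (by simp)),
          fun x hx => h1 (by simp [hx]), fun x hx y hxy => h1 ?_⟩
        simp only [Finset.mem_insert, Finset.mem_union, Finset.mem_biUnion,
          SimpleGraph.mem_neighborFinset]
        exact Or.inr (Or.inr ⟨x, hx, hxy⟩)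
      · rintro Λ ⟨hΛ, hnb⟩
        -- The remainder `R` consists of the edges avoiding `Λ₀` and the boundary weights summed
        -- over `k`, the unknown class at the pinned root.
        refine ⟨hnb, hΛ.1, fun a =>
          (∏ b ∈ edgesAvoiding G Λ₀ Λ, edgeWeight Q a b) *
            ∑ k : ZMod q, κ * boundaryWeight G o Q lam Λ fun v => (a v : ZMod q) + k,
          fun a => ?_, fun a b hab => ?_, fun a hao => ?_⟩
        · exact mul_pos (Finset.prod_pos fun b _ => edgeWeight_pos hpos a b)
            (Finset.sum_pos (fun k _ => mul_pos hκ0 (boundaryWeight_pos hpos hQ h.pos _ _ _))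
              Finset.univ_nonempty)
        · beta_reduce
          congr 1
          · refine Finset.prod_congr rfl fun e he => ?_
            induction e using Sym2.ind with
            | _ x y =>
              rw [edgesAvoiding, Finset.mem_sdiff, mem_edgesIn, mem_edgesMeeting] at he
              have hx : x ∉ Λ₀ := fun hx => he.2 ⟨he.1.1, Or.inl hx⟩
              have hy : y ∉ Λ₀ := fun hy => he.2 ⟨he.1.1, Or.inr hy⟩
              exact edgeWeight_congr (by rw [hab x hx, hab y hy])
          · refine Finset.sum_congr rfl fun k _ => ?_
            rw [boundaryWeight_congr hG hpos hQ hreg h ho hΛ hnb fun x hx => by rw [hab x hx]]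
        · rw [hm, Measure.map_apply hpin (measurableSet_cylinder Λ a), ← mul_assoc,
            ← prod_inner_eq_boltzmannWeight_mul hG heven o hnb,
            ← gradientMeasure_gradCylinder hG heven hpos hQ h.pos hκ hΛ]
          refine measure_congr ?_
          filter_upwards [hgrad] with ζ hζ
          obtain ⟨ω, rfl⟩ := hζ
          refine propext ?_
          change (∀ x ∈ Λ, pinnedHeights G o (grad G ω) x = a x) ↔ grad G ω ∈ gradCylinder G Λ a
          simp only [grad_mem_gradCylinder_iff hG o, pinnedHeights_grad hG, inner_of_isRooted hΛ,
            Finset.mem_erase]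
          constructor
          · rintro hx v ⟨-, hv⟩
            rw [← hx v hv, ← hx _ (hΛ.2 v hv)]
            ring
          · intro hx
            refine fun x => tree_induction hG o (P := fun x => x ∈ Λ → ω x - ω o = a x)
              (fun _ => by rw [sub_self, hao]) (fun v hv ih hvΛ => ?_) x
            have h1 := hx v ⟨hv, hvΛ⟩
            have h2 := ih (hΛ.2 v hvΛ)
            omega
    have hgA : MeasurableSet (grad G ⁻¹' A) := measurable_grad hA
    calc ∫⁻ ζ, gradientKernel G Q Λ₀ ζ A ∂ν
        = ∫⁻ ζ, gibbsKernel G Q Λ₀ (pinnedHeights G o ζ) (grad G ⁻¹' A) ∂ν := by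
          refine lintegral_congr_ae ?_
          filter_upwards [hgrad] with ζ hζ
          exact gradientKernel_apply hG o Λ₀ hζ hA
      _ = ∫⁻ ω, gibbsKernel G Q Λ₀ ω (grad G ⁻¹' A) ∂m := by
          have hk : Measurable fun ω : V → ℤ => gibbsKernel G Q Λ₀ ω (grad G ⁻¹' A) :=
            (Measure.measurable_coe hgA).comp (measurable_gibbsKernel Λ₀)
          rw [hm, lintegral_map hk hpin]
      _ = m (grad G ⁻¹' A) := by
          rw [← Measure.bind_apply hgA (measurable_gibbsKernel Λ₀).aemeasurable, hbind]
      _ = ν A := by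
          rw [hm, Measure.map_apply hpin hgA]
          refine measure_congr ?_
          filter_upwards [hgrad] with ζ hζ
          refine propext ?_
          change grad G (pinnedHeights G o ζ) ∈ A ↔ ζ ∈ A
          rw [grad_pinnedHeights hG o hζ]

end DLR

/-! ### Comparison with the free state -/

section FreeState

variable {V : Type*} {G : SimpleGraph V} {Q : ℤ → ℝ} {d q : ℕ} {lam : ZMod q → ℝ}

/-- A single increment of the free state has the law `Q` normalized. -/
theorem freeState_increment (heven : ∀ i, Q (-i) = Q i) (hpos : ∀ i, 0 < Q i) (hQ : Summable Q)
    (e : G.Dart) (j : ℤ) :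
    freeState G Q {η | η e = j} = ENNReal.ofReal (Q j / ∑' i, Q i) := by
  classical
  have hS : 0 < ∑' i, Q i := hQ.tsum_pos (fun i => (hpos i).le) 0 (hpos 0)
  have hlaw : IsProbabilityMeasure (incrementLaw Q) := by
    refine isProbabilityMeasure_law (fun j => (div_pos (hpos j) hS).le) ?_
    have := hQ.hasSum.div_const (∑' i, Q i)
    rwa [div_self hS.ne'] at this
  have hsing : ∀ j, incrementLaw Q {j} = ENNReal.ofReal (Q j / ∑' i, Q i) := law_singleton _
  rw [freeState, Measure.map_apply]
  · have heval : ∀ k : ℤ, (Measure.infinitePi fun _ : G.edgeSet => incrementLaw Q)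
        {X | X ⟨e.edge, e.edge_mem⟩ = k} = ENNReal.ofReal (Q k / ∑' i, Q i) := by
      intro k
      have h := congrArg (fun μ : Measure ℤ => μ {k})
        (Measure.infinitePi_map_eval (fun _ : G.edgeSet => incrementLaw Q) ⟨e.edge, e.edge_mem⟩)
      beta_reduce at h
      have hev : Measurable fun X : G.edgeSet → ℤ => X ⟨e.edge, e.edge_mem⟩ := measurable_pi_apply _
      rw [Measure.map_apply hev (measurableSet_singleton k), hsing] at h
      exact h
    by_cases he : e.toProd = Quot.out e.edge
    · rw [← heval]
      congr 1
      ext X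
      simp [he]
    · rw [← heven, ← heval]
      congr 1
      ext X
      simp [he, neg_eq_iff_eq_neg]
  · refine measurable_pi_lambda _ fun e => ?_
    split_ifs
    exacts [measurable_pi_apply _, (measurable_pi_apply _).neg]
  · exact measurableSet_eq_fun (measurable_pi_apply e) measurable_const

variable [NeZero q]

/-- Apply the cylinder formula to the two endpoints of `e`, rooted at the first one: the `fuzzyNorm`
in the root weight cancels the denominator of the only transition, leaving the autocorrelation of
`lam`. -/
theorem gradientMeasure_increment [G.LocallyFinite] (hG : G.IsTree) (heven : ∀ i, Q (-i) = Q i)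
    (hpos : ∀ i, 0 < Q i) (hQ : Summable Q) (hlam : ∀ s, 0 < lam s) {κ : ℝ}
    (hκ : ∀ s, fuzzyStationary d lam s = κ * (lam s * fuzzyNorm Q lam s))
    (e : G.Dart) (j : ℤ) :
    gradientMeasure G e.fst Q d lam {η | η e = j}
      = ENNReal.ofReal (Q j * (κ * ∑ s : ZMod q, lam s * lam (s + j))) := by
  classical
  obtain ⟨⟨x, y⟩, hxy⟩ := e
  simp only at hxy ⊢
  have hne : y ≠ x := hxy.ne'
  have hpar : parent G x y = x := parent_eq hG hxy (by
    rw [SimpleGraph.dist_self, SimpleGraph.dist_eq_one_iff_adj.2 hxy])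
  have hroot : IsRooted G x {x, y} := by
    refine ⟨by simp, fun v hv => ?_⟩
    rcases Finset.mem_insert.1 hv with rfl | hv
    · rw [parent_root]; simp
    · rw [Finset.mem_singleton.1 hv, hpar]; simp
  have hinner : inner G x {x, y} = {y} := by
    rw [inner_of_isRooted hroot]
    ext v
    simp only [Finset.mem_erase, Finset.mem_insert, Finset.mem_singleton]
    constructor
    · tauto
    · rintro rfl; exact ⟨hne, Or.inr rfl⟩
  set a : V → ℤ := fun v => if v = y then j else 0 with ha
  have hay : a y = j := by simp [ha]
  have hax : a x = 0 := by simp [ha, hne.symm]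
  have hae := incrementMeasure_ae_grad hG x (fuzzyChain G x Q d lam) fun s j => rho Q j s
  have hset : gradientMeasure G x Q d lam {η | η ⟨(x, y), hxy⟩ = j}
      = gradientMeasure G x Q d lam (gradCylinder G {x, y} a) := by
    refine measure_congr ?_
    filter_upwards [hae] with ζ hζ
    obtain ⟨ω, rfl⟩ := hζ
    refine propext ?_
    change grad G ω ⟨(x, y), hxy⟩ = j ↔ grad G ω ∈ gradCylinder G {x, y} a
    simp only [grad_mem_gradCylinder_iff hG x, hinner, Finset.mem_singleton, forall_eq, hpar,
      hay, hax, grad, sub_zero]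
  rw [hset, gradientMeasure_gradCylinder hG heven hpos hQ hlam hκ hroot a]
  simp only [boundaryWeight, hinner, Finset.prod_singleton, hpar, hay, hax, sub_zero, Int.cast_zero,
    zero_add]
  congr 2
  rw [Finset.mul_sum]
  refine Finset.sum_congr rfl fun k _ => ?_
  have := (fuzzyNorm_pos hpos hQ hlam k).ne'
  rw [add_comm (j : ZMod q)]
  field_simp

/-- Equality would make the autocorrelation of `lam` the same at shifts 0 and 1. Then the squares
`(lam s - lam (s + 1)) ^ 2` sum to zero, so `lam` is invariant under the shift by 1 and hence
constant on `ZMod q`. -/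
theorem gradientMeasure_ne_freeState [G.LocallyFinite] (hG : G.IsTree)
    (hreg : G.IsRegularOfDegree (d + 1)) (heven : ∀ i, Q (-i) = Q i)
    (hpos : ∀ i, 0 < Q i) (hQ : Summable Q) (hd : 1 ≤ d) (h : IsPeriodicBoundaryLaw Q d lam)
    (hne : ∃ s t, lam s ≠ lam t) (w : V) : gradientMeasure G w Q d lam ≠ freeState G Q := by
  intro heq
  obtain ⟨κ, hκ0, hκ⟩ := exists_fuzzyStationary_eq hpos hQ hd h
  have hdeg : 0 < (G.neighborFinset w).card := by
    have : (G.neighborFinset w).card = d + 1 := hreg w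
    omega
  obtain ⟨y, hy⟩ := Finset.card_pos.1 hdeg
  rw [SimpleGraph.mem_neighborFinset] at hy
  have hS : 0 < ∑' i, Q i := hQ.tsum_pos (fun i => (hpos i).le) 0 (hpos 0)
  have hval : ∀ j : ℤ, κ * ∑ s : ZMod q, lam s * lam (s + j) = 1 / ∑' i, Q i := by
    intro j
    have h1 := gradientMeasure_increment hG heven hpos hQ h.pos hκ (⟨(w, y), hy⟩ : G.Dart) j
    simp only at h1
    rw [heq, freeState_increment heven hpos hQ, ENNReal.ofReal_eq_ofReal_iff
      (div_pos (hpos j) hS).le (mul_nonneg (hpos j).le (mul_nonneg hκ0.le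
        (Finset.sum_nonneg fun s _ => mul_nonneg (h.pos _).le (h.pos _).le)))] at h1
    have := (hpos j).ne'
    field_simp at h1 ⊢
    linarith
  have h01 : ∑ s : ZMod q, lam s * lam (s + 1) = ∑ s : ZMod q, lam s * lam s := by
    have h0 := hval 0
    have h1 := hval 1
    rw [← h1] at h0
    simpa using (mul_left_cancel₀ hκ0.ne' h0).symm
  have hshift : ∑ s : ZMod q, lam (s + 1) * lam (s + 1) = ∑ s : ZMod q, lam s * lam s :=
    Equiv.sum_comp (Equiv.addRight (1 : ZMod q)) fun s => lam s * lam s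
  have hsq : ∑ s : ZMod q, (lam s - lam (s + 1)) ^ 2 = 0 := by
    have : ∀ s : ZMod q, (lam s - lam (s + 1)) ^ 2
        = lam s * lam s + lam (s + 1) * lam (s + 1) - 2 * (lam s * lam (s + 1)) := fun s => by ring
    simp only [this]
    rw [Finset.sum_sub_distrib, Finset.sum_add_distrib, ← Finset.mul_sum, h01, hshift]
    ring
  have hstep : ∀ s : ZMod q, lam (s + 1) = lam s := fun s => by
    have := (Finset.sum_eq_zero_iff_of_nonneg fun s _ => sq_nonneg (lam s - lam (s + 1))).1 hsq s
      (Finset.mem_univ s)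
    exact (sub_eq_zero.1 (pow_eq_zero_iff two_ne_zero |>.1 this)).symm
  have hconst : ∀ n : ℕ, lam (n : ZMod q) = lam 0 := by
    intro n
    induction n with
    | zero => simp
    | succ n ih => rw [Nat.cast_succ, hstep, ih]
  obtain ⟨s, t, hst⟩ := hne
  refine hst ?_
  rw [← ZMod.natCast_zmod_val s, ← ZMod.natCast_zmod_val t, hconst, hconst]

/-- A non-constant boundary law gives an automorphism invariant gradient Gibbs measure different
from the free state. -/
theorem exists_gradientGibbsMeasure [G.LocallyFinite] (hG : G.IsTree)
    (hreg : G.IsRegularOfDegree (d + 1)) (heven : ∀ i, Q (-i) = Q i)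
    (hpos : ∀ i, 0 < Q i) (hQ : Summable Q) (hd : 1 ≤ d) (h : IsPeriodicBoundaryLaw Q d lam)
    (hne : ∃ s t, lam s ≠ lam t) :
    ∃ ν : Measure (G.Dart → ℤ), IsTwoLayerMeasure G Q d lam ν ∧ IsGradientGibbsMeasure G Q ν ∧
      IsAutomorphismInvariant G ν ∧ ν ≠ freeState G Q := by
  obtain ⟨w⟩ := hG.connected.nonempty
  exact ⟨gradientMeasure G w Q d lam,
    isTwoLayerMeasure_gradientMeasure hG heven hpos hQ hd h w,
    isGradientGibbsMeasure_gradientMeasure hG hreg heven hpos hQ hd h w,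
    isAutomorphismInvariant_gradientMeasure hG heven hpos hQ hd h w,
    gradientMeasure_ne_freeState hG hreg heven hpos hQ hd h hne w⟩

end FreeState

end TreeGradient

end

theorem theorem3p3 (d : ℕ) (hd : 2 ≤ d) (Q : ℤ → ℝ)
    (hQ_even : ∀ i, Q (-i) = Q i) (hQ_pos : ∀ i, 0 < Q i) (hQ_zero : Q 0 = 1)
    (hQ_l1 : Memℓp Q 1) :
    ((TreeGradient.pNorm 1 Q, TreeGradient.pNormOffZero 1 Q) ∈ TreeGradient.goodSet d →
      ∀ (q : ℕ) [NeZero q], 2 ≤ q →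
        ∃ lam : ZMod q → ℝ, TreeGradient.IsPeriodicBoundaryLaw Q d lam ∧
          ∀ (V : Type*) (G : SimpleGraph V) [G.LocallyFinite],
            G.IsTree → G.IsRegularOfDegree (d + 1) →
            ∃ ν : Measure (G.Dart → ℤ),
              TreeGradient.IsTwoLayerMeasure G Q d lam ν ∧
              TreeGradient.IsGradientGibbsMeasure G Q ν ∧
              TreeGradient.IsAutomorphismInvariant G ν ∧
              ν ≠ TreeGradient.freeState G Q) ∧
    (TreeGradient.DoubleSumCondition Q d →
      (TreeGradient.pNorm (((d : ℝ) + 1) / 2) Q, TreeGradient.pNormOffZero ((d : ℝ) + 1) Q) ∈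
        interior (TreeGradient.goodSet d) →
      ∃ q₀ : ℕ, ∀ (q : ℕ) [NeZero q], q₀ ≤ q →
        ∃ lam : ZMod q → ℝ, TreeGradient.IsPeriodicBoundaryLaw Q d lam ∧
          ∀ (V : Type*) (G : SimpleGraph V) [G.LocallyFinite],
            G.IsTree → G.IsRegularOfDegree (d + 1) →
            ∃ ν : Measure (G.Dart → ℤ),
              TreeGradient.IsTwoLayerMeasure G Q d lam ν ∧
              TreeGradient.IsGradientGibbsMeasure G Q ν ∧
              TreeGradient.IsAutomorphismInvariant G ν ∧
              ν ≠ TreeGradient.freeState G Q) := by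
  have hQ : Summable Q := by
    have h := (memℓp_gen_iff (p := 1) (by simp)).1 hQ_l1
    simp only [ENNReal.toReal_one, Real.rpow_one] at h
    exact summable_norm_iff.1 h
  refine ⟨fun hgood q _ hq => ?_, fun _ _ => ?_⟩
  · obtain ⟨lam, hlam, hne⟩ := TreeGradient.exists_boundaryLaw_of_mem_goodSet hd hQ_even hQ_pos
      hQ_zero hQ hgood hq
    exact ⟨lam, hlam, fun V G _ hG hreg => TreeGradient.exists_gradientGibbsMeasure hG hreg hQ_even
      hQ_pos hQ (by omega) hlam hne⟩
  -- The threshold is any natural number above the `(d + 1)`-st power of the sum of `Q`, and at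
  -- least 2 so that `ZMod q` is nontrivial.
  · obtain ⟨n, hn⟩ := exists_nat_gt ((∑' i, Q i) ^ (d + 1))
    refine ⟨max 2 n, fun q _ hq => ?_⟩
    obtain ⟨lam, hlam, hne⟩ := TreeGradient.exists_boundaryLaw_of_large hd hQ_even hQ_pos
      hQ_zero hQ ((le_max_left 2 n).trans hq)
      (hn.trans_le (by exact_mod_cast (le_max_right 2 n).trans hq))
    exact ⟨lam, hlam, fun V G _ hG hreg => TreeGradient.exists_gradientGibbsMeasure hG hreg hQ_even
      hQ_pos hQ (by omega) hlam hne⟩
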